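/- A group $G$ has the \emph{Magnus property} if any two elements $x,y\in G$ with the same normal closure in $G$ satisfy: $x$ is conjugate in $G$ to $y$ or to $y^{-1}$. Write $a^z=z^{-1}az$ and $[a,b]=a^{-1}b^{-1}ab$. \textbf{Proposition.} The Magnus property is not preserved under direct products within the class of finitely generated, torsion-free, residually finite groups. Explicitly, let $$G=\langle x,y \mid x^{-1}y^2x=y^{-2},\ y^{-1}x^2y=x^{-2}\rangle$$ be the Hantzsche–Wendt group, and let $H=G_3$ be the $8$-dimensional crystallographic group generated by $u,v$ and $e_i,\hat e_i$ for $i\in\{\infty,0,1,2\}$, subject to the following defining relations: the eight elements $e_i,\hat e_i$ commute pairwise; $$e_\infty^u=e_\infty,\quad \hat e_\infty^u=\hat e_\infty,\qquad e_i^u=\hat e_i,\quad \hat e_i^u=e_i^{-1}\hat e_i^{-1}\quad (i=0,1,2);$$ $$e_i^v=\hat e_i,\quad \hat e_i^v=e_i^{-1}\hat e_i^{-1}\quad (i=\infty,1),\qquad e_0^v=e_0,\quad \hat e_0^v=\hat e_0,\qquad e_2^v=e_2^{-1}\hat e_2^{-1},\quad \hat e_2^v=e_2;$$ $$u^3=e_\infty^{-2}\hat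 e_\infty^{-1},\qquad v^3=e_0^2\hat e_0,\qquad [u,v]=e_\infty e_0e_1e_2.$$ Then $G$ and $H$ are finitely generated, torsion-free, residually finite groups with the Magnus property, and $G\times H$ is again finitely generated, torsion-free and residually finite, but does not have the Magnus property. -/

import Mathlib

/-- A group has the Magnus property if any two elements with the same normal closure are
conjugate up to inversion. -/
def HasMagnusProperty (G : Type*) [Group G] : Prop :=
  ∀ x y : G, Subgroup.normalClosure {x} = Subgroup.normalClosure {y} →
    IsConj x y ∨ IsConj x y⁻¹

/-- The class of finitely generated, torsion-free, residually finite groups. Torsion-free means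
that only the identity has finite order. (Mathlib's `IsMulTorsionFree` asks for unique roots,
which is stronger for non-abelian groups.) -/
structure IsFGTorsionFreeResiduallyFinite (G : Type*) [Group G] : Prop where
  fg : Group.FG G
  torsionFree : ∀ g : G, IsOfFinOrder g → g = 1
  residuallyFinite : Group.ResiduallyFinite G

/-- The commutator `[a, b] = a⁻¹ b⁻¹ a b`. -/
def rightComm {G : Type*} [Group G] (a b : G) : G := a⁻¹ * b⁻¹ * a * b

/-- The conjugate `a ^ z = z⁻¹ a z`. -/
def rightConj {G : Type*} [Group G] (a z : G) : G := z⁻¹ * a * z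

/-! ### The Hantzsche-Wendt group -/

inductive HWGen : Type
  | x
  | y

/-- The relations `x⁻¹ y² x = y⁻²` and `y⁻¹ x² y = x⁻²`. -/
def hwRels : Set (FreeGroup HWGen) :=
  let x := FreeGroup.of HWGen.x
  let y := FreeGroup.of HWGen.y
  { rightConj (y ^ 2) x * (y ^ (-2 : ℤ))⁻¹,
    rightConj (x ^ 2) y * (x ^ (-2 : ℤ))⁻¹ }

/-- The Hantzsche-Wendt group `⟨x, y ∣ x⁻¹ y² x = y⁻², y⁻¹ x² y = x⁻²⟩`. -/
abbrev HantzscheWendtGroup : Type := PresentedGroup hwRels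

/-! ### The 8-dimensional group `G_3` -/

/-- The eight generators `e_i`, `ê_i` (written `e'_i` here), for `i = ∞, 0, 1, 2`,
of the lattice. -/
inductive LatticeGen : Type
  | eInf
  | eInf'
  | e0
  | e0'
  | e1
  | e1'
  | e2
  | e2'

/-- The generators of `G_3`: `u`, `v` and the eight lattice generators. -/
inductive G3Gen : Type
  | u
  | v
  | lat (a : LatticeGen)

/-- A lattice generator, as an element of the free group on the generators of `G_3`. -/
def latWord (a : LatticeGen) : FreeGroup G3Gen := FreeGroup.of (G3Gen.lat a)

open LatticeGen in
/-- The word `c_{a,u}` for which `a ^ u = c_{a,u}` is a relation. -/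
def conjUWord : LatticeGen → FreeGroup G3Gen
  | eInf => latWord eInf
  | eInf' => latWord eInf'
  | e0 => latWord e0'
  | e0' => (latWord e0)⁻¹ * (latWord e0')⁻¹
  | e1 => latWord e1'
  | e1' => (latWord e1)⁻¹ * (latWord e1')⁻¹
  | e2 => latWord e2'
  | e2' => (latWord e2)⁻¹ * (latWord e2')⁻¹

open LatticeGen in
/-- The word `c_{a,v}` for which `a ^ v = c_{a,v}` is a relation. -/
def conjVWord : LatticeGen → FreeGroup G3Gen
  | eInf => latWord eInf'
  | eInf' => (latWord eInf)⁻¹ * (latWord eInf')⁻¹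
  | e0 => latWord e0
  | e0' => latWord e0'
  | e1 => latWord e1'
  | e1' => (latWord e1)⁻¹ * (latWord e1')⁻¹
  | e2 => (latWord e2)⁻¹ * (latWord e2')⁻¹
  | e2' => latWord e2

open LatticeGen in
/-- The relations of `G_3`: the lattice generators commute, `u` and `v` act on them as
prescribed, and `u³ = e_∞⁻² ê_∞⁻¹`, `v³ = e_0² ê_0`, `[u, v] = e_∞ e_0 e_1 e_2`. -/
def g3Rels : Set (FreeGroup G3Gen) :=
  let u := FreeGroup.of G3Gen.u
  let v := FreeGroup.of G3Gen.v
  {r | ∃ a b : LatticeGen, r = rightComm (latWord a) (latWord b)} ∪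
  {r | ∃ a : LatticeGen, r = rightConj (latWord a) u * (conjUWord a)⁻¹} ∪
  {r | ∃ a : LatticeGen, r = rightConj (latWord a) v * (conjVWord a)⁻¹} ∪
  { u ^ 3 * (latWord eInf ^ (-2 : ℤ) * (latWord eInf')⁻¹)⁻¹,
    v ^ 3 * (latWord e0 ^ 2 * latWord e0')⁻¹,
    rightComm u v * (latWord eInf * latWord e0 * latWord e1 * latWord e2)⁻¹ }

/-- The group `G_3 ≅ (C₃ × C₃).ℤ⁸`, given by its presentation. -/
abbrev GroupG3 : Type := PresentedGroup g3Rels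

/-! Both groups are crystallographic with point group `(ℤ/p)²`, where `p = 2` or `p = 3`. Write `π =
1 - ζ_p`. The lattice is a sum of rank one blocks over `ℤ[ζ_p]`, one for each point of the
projective line over `𝔽_p`, on which the point group acts through a character `χ j`. The translation
part in block `j` is prescribed modulo `π` by a linear form `f j`, and the determinant of the pair
`(f j, χ j)` does not depend on `j`. The presented groups are shown isomorphic to these models
(`Crystal.bijective_of_lattice`), and the models are treated uniformly.

Magnus property of a model. If `x` is a translation, then `y` in its normal closure is obtained by
multiplying the blocks by values of one group ring element. When `x` is also in the normal closure
of `y`, these values are units on the support of `x`. Modulo torsion units there is nothing else,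
and reduction modulo `π²` shows that one sign and one point group element serve all blocks
(`magnus_translation`). If `x` has nontrivial point part, it fixes exactly one block `i`. Modulo a
lattice containing all commutators with `x`, the element `y` is a power of `x`, and the exponent may
be taken to be `±1`; units in block `i` then determine a conjugator (`isConj_of_inv_mul_mem`).

Failure for the product. If `x` becomes central in a quotient, its image has order dividing 4; if
`u` does, its image has order dividing 3. Modulo a normal subgroup containing `(x, u)` or `(x,
u⁻¹)`, both become central and are equal up to inversion, so both die. Hence these two pairs have
the same normal closure. Abelian quotients show that neither `u` nor `x` is conjugate to its
inverse, so the pairs are not conjugate up to inversion. -/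

section

/-! ### Crystallographic groups built from characters of `(ℤ/p)²` -/

/-- Arithmetic data for a crystallographic group with point group `(ℤ/p)²`. The ring `E` plays the
role of `ℤ[ζ_p]`, `z k` that of `ζ ^ k`, and `ε` is reduction modulo the prime `1 - ζ`. The lattice
is a sum of rank one blocks indexed by `J`; the point group acts on block `j` through the character
`χ j`, and `f j` prescribes translation parts modulo `1 - ζ`. -/
structure CrystalData (p : ℕ) (E : Type) [CommRing E] (J : Type) where
  z : ZMod p → E
  z_zero : z 0 = 1
  z_add : ∀ a b, z (a + b) = z a * z b
  ε : E →+* ZMod p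
  ε_z : ∀ k, ε (z k) = 1
  exists_of_ε_eq_zero : ∀ a, ε a = 0 → ∃ b, a = (1 - z 1) * b
  uniformizer_ne_zero : 1 - z 1 ≠ 0
  exists_one_sub_z : ∀ k, ∃ w, 1 - z k = (1 - z 1) * w ∧ ε w = k ∧ (k ≠ 0 → IsUnit w)
  -- The modulus `m` is divisible by `(1 - ζ)²`, yet every integer prime to `p` is `±1` modulo `m`.
  -- For prime `p` this leaves only `p = 2` and `p = 3`.
  m : ℕ
  p_dvd_m : p ∣ m
  m_eq : ∃ w, (m : E) = (1 - z 1) * w ∧ ε w = 0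
  m_dvd : ∀ n : ℤ, (n : ZMod p) ≠ 0 → (m : ℤ) ∣ n - 1 ∨ (m : ℤ) ∣ n + 1
  unit_eq : ∀ u : E, IsUnit u → ε u = 1 → ∃ k, u = z k
  exists_finite_quotient : ∀ a : E, a ≠ 0 →
    ∃ (R : Type) (_ : CommRing R) (_ : Finite R) (φ : E →+* R), φ a ≠ 0
  χ : J → (ZMod p × ZMod p →+ ZMod p)
  f : J → (ZMod p × ZMod p →+ ZMod p)
  -- The right side is the same for all blocks. This makes the commutators of any two elements have
  -- one common residue in all blocks, after division by `1 - ζ`.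
  det_eq : ∀ j a b, f j b * χ j a - f j a * χ j b = a.1 * b.2 - a.2 * b.1
  χ_surjective : ∀ j, Function.Surjective (χ j)
  exists_χ_eq_zero : ∀ a, a ≠ 0 → ∃ i, χ i a = 0 ∧ ∀ j, j ≠ i → χ j a ≠ 0

variable {p : ℕ} {E J : Type} [CommRing E]

/-- Affine maps with point part `pt` and translation part `tr`, the latter congruent modulo `1 - ζ`
to the value that `pt` prescribes. -/
@[ext]
structure Crystal (D : CrystalData p E J) where
  pt : ZMod p × ZMod p
  tr : J → E
  ε_tr : ∀ j, D.ε (tr j) = D.f j pt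

namespace CrystalData

variable (D : CrystalData p E J)

theorem z_neg_mul (k : ZMod p) : D.z (-k) * D.z k = 1 := by
  rw [← D.z_add, neg_add_cancel, D.z_zero]

theorem z_mul_neg (k : ZMod p) : D.z k * D.z (-k) = 1 := by
  rw [mul_comm, D.z_neg_mul]

theorem ε_uniformizer_mul (b : E) : D.ε ((1 - D.z 1) * b) = 0 := by
  simp [D.ε_z]

end CrystalData

namespace Crystal

variable {D : CrystalData p E J}

instance : One (Crystal D) := ⟨⟨0, 0, by simp⟩⟩

instance : Mul (Crystal D) :=
  ⟨fun g h => ⟨g.pt + h.pt, fun j => D.z (D.χ j h.pt) * g.tr j + h.tr j, fun j => by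
    simp [D.ε_z, g.ε_tr, h.ε_tr]⟩⟩

instance : Inv (Crystal D) :=
  ⟨fun g => ⟨-g.pt, fun j => -(D.z (-D.χ j g.pt) * g.tr j), fun j => by
    simp [D.ε_z, g.ε_tr]⟩⟩

@[simp] theorem pt_one : (1 : Crystal D).pt = 0 := rfl
@[simp] theorem tr_one (j : J) : (1 : Crystal D).tr j = 0 := rfl
@[simp] theorem pt_mul (g h : Crystal D) : (g * h).pt = g.pt + h.pt := rfl
@[simp] theorem tr_mul (g h : Crystal D) (j : J) :
    (g * h).tr j = D.z (D.χ j h.pt) * g.tr j + h.tr j := rfl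
@[simp] theorem pt_inv (g : Crystal D) : g⁻¹.pt = -g.pt := rfl
@[simp] theorem tr_inv (g : Crystal D) (j : J) :
    g⁻¹.tr j = -(D.z (-D.χ j g.pt) * g.tr j) := rfl

theorem ext' {g h : Crystal D} (h1 : g.pt = h.pt) (h2 : ∀ j, g.tr j = h.tr j) : g = h :=
  Crystal.ext h1 (funext h2)

instance : Group (Crystal D) :=
  Group.ofLeftAxioms
    (fun a b c => ext' (by simp [add_assoc]) fun j => by simp [D.z_add]; ring)
    (fun a => ext' (by simp) fun j => by simp)
    (fun a => ext' (by simp) fun j => by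
      simp only [tr_mul, tr_inv, tr_one]
      linear_combination (-a.tr j) * D.z_mul_neg (D.χ j a.pt))

/-- The point part, as a homomorphism. -/
def ptHom : Crystal D →* Multiplicative (ZMod p × ZMod p) where
  toFun g := Multiplicative.ofAdd g.pt
  map_one' := rfl
  map_mul' _ _ := rfl

theorem pt_zpow (g : Crystal D) (n : ℤ) : (g ^ n).pt = n • g.pt :=
  congrArg Multiplicative.toAdd (map_zpow (ptHom (D := D)) g n)

theorem pt_pow (g : Crystal D) (n : ℕ) : (g ^ n).pt = n • g.pt :=
  congrArg Multiplicative.toAdd (map_pow (ptHom (D := D)) g n)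

theorem tr_pow (g : Crystal D) {j : J} (hg : D.χ j g.pt = 0) (n : ℕ) :
    (g ^ n).tr j = n * g.tr j := by
  induction n with
  | zero => simp
  | succ n ih => rw [pow_succ, tr_mul, ih, hg, D.z_zero]; push_cast; ring

theorem tr_zpow (g : Crystal D) {j : J} (hg : D.χ j g.pt = 0) (n : ℤ) :
    (g ^ n).tr j = n * g.tr j := by
  cases n with
  | ofNat n => simpa using tr_pow g hg n
  | negSucc n =>
    rw [zpow_negSucc, tr_inv, tr_pow g hg, pt_pow, map_nsmul, hg]
    simp [D.z_zero]; ring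

theorem tr_conj (g h : Crystal D) (j : J) : (h⁻¹ * g * h).tr j =
    D.z (D.χ j h.pt) * g.tr j + h.tr j * (1 - D.z (D.χ j g.pt)) := by
  simp only [tr_mul, tr_inv]
  linear_combination (-D.z (D.χ j g.pt) * h.tr j) * D.z_mul_neg (D.χ j h.pt)

/-- If `χ i` and `f i` both killed the point part, the determinant of the point part with every
vector would vanish. -/
theorem tr_ne_zero_of_pt_ne_zero {g : Crystal D} (hg : g.pt ≠ 0) {i : J} (hi : D.χ i g.pt = 0) :
    D.ε (g.tr i) ≠ 0 := by
  intro h0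
  rw [g.ε_tr] at h0
  apply hg
  have h1 := D.det_eq i g.pt (0, 1)
  have h2 := D.det_eq i g.pt (1, 0)
  rw [hi, h0] at h1 h2
  simp only [mul_zero, zero_mul, sub_zero, mul_one, zero_sub] at h1 h2
  exact Prod.ext h1.symm (neg_eq_zero.1 h2.symm)

/-- On a block fixed by the point part, powers multiply the translation part by the exponent, so
torsion forces it to be zero there. A nontrivial point part fixes a block where it is nonzero. -/
theorem eq_one_of_isOfFinOrder [NoZeroDivisors E] [CharZero E] (g : Crystal D)
    (hg : IsOfFinOrder g) : g = 1 := by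
  obtain ⟨n, hn, h⟩ := isOfFinOrder_iff_pow_eq_one.1 hg
  have key : ∀ j, D.χ j g.pt = 0 → g.tr j = 0 := fun j hj => by
    have := tr_pow g hj n
    rw [h, tr_one] at this
    simpa [hn.ne'] using this.symm
  have hpt : g.pt = 0 := by
    by_contra hne
    obtain ⟨i, hi, -⟩ := D.exists_χ_eq_zero g.pt hne
    exact tr_ne_zero_of_pt_ne_zero hne hi (by simp [key i hi])
  exact ext' hpt fun j => key j (by simp [hpt])

/-- The action of a crystallographic group on block `j`, reduced to a quotient ring. -/
@[reducible]
def blockAction {R : Type} [CommRing R] (φ : E →+* R) (j : J) : MulAction (Crystal D) R where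
  smul g t := φ (D.z (-D.χ j g.pt)) * (t - φ (g.tr j))
  one_smul t := by
    change φ (D.z (-D.χ j 0)) * (t - φ 0) = t
    simp [D.z_zero]
  mul_smul g h t := by
    change φ (D.z (-D.χ j (g.pt + h.pt))) * (t - φ (D.z (D.χ j h.pt) * g.tr j + h.tr j)) =
      φ (D.z (-D.χ j g.pt)) * (φ (D.z (-D.χ j h.pt)) * (t - φ (h.tr j)) - φ (g.tr j))
    have h1 : φ (D.z (-D.χ j h.pt)) * φ (D.z (D.χ j h.pt)) = 1 := by
      rw [← map_mul, D.z_neg_mul, map_one]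
    rw [map_add, neg_add, D.z_add]
    simp only [map_add, map_mul]
    linear_combination (-φ (D.z (-D.χ j g.pt)) * φ (g.tr j)) * h1

/-- A nontrivial point part is seen in the point group. A translation with a nonzero coordinate
moves `0` when that block acts affinely on a suitable finite quotient of `E`. -/
theorem residuallyFinite [NeZero p] : Group.ResiduallyFinite (Crystal D) := by
  refine Group.residuallyFinite_of_forall_exists_finite_monoidHom fun g hg => ?_
  by_cases hpt : g.pt = 0
  · obtain ⟨j, hj⟩ : ∃ j, g.tr j ≠ 0 := by
      by_contra! h
      exact hg (ext' hpt h)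
    obtain ⟨R, _, _, φ, hφ⟩ := D.exists_finite_quotient _ hj
    let _ := blockAction (D := D) φ j
    refine ⟨Equiv.Perm R, inferInstance, inferInstance, MulAction.toPermHom (Crystal D) R, ?_⟩
    intro h
    have h0 : g • (0 : R) = 0 := DFunLike.congr_fun h 0
    change φ (D.z (-D.χ j g.pt)) * (0 - φ (g.tr j)) = 0 at h0
    rw [hpt] at h0
    simp [D.z_zero] at h0
    exact hφ h0
  · exact ⟨Multiplicative (ZMod p × ZMod p), inferInstance, inferInstance, ptHom, hpt⟩

theorem exists_pt_eq (a : ZMod p × ZMod p) : ∃ g : Crystal D, g.pt = a := by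
  refine ⟨⟨a, fun j => ((D.f j a).cast : ℤ), fun j => by simp⟩, rfl⟩

end Crystal

/-! ### Units modulo `(1 - ζ)²` -/

namespace CrystalData

variable (D : CrystalData p E J)

theorem z_ne_one [NoZeroDivisors E] {k : ZMod p} (hk : k ≠ 0) : 1 - D.z k ≠ 0 := by
  obtain ⟨w, hw, hwk, -⟩ := D.exists_one_sub_z k
  rw [hw]
  refine mul_ne_zero D.uniformizer_ne_zero ?_
  rintro rfl
  exact hk (by simpa using hwk.symm)

/-- A unit congruent to an integer `a` modulo `1 - ζ` is a root of unity up to a sign `s` depending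
only on `a`; the root of unity is determined modulo `(1 - ζ)²`. -/
theorem exists_sign [Fact p.Prime] [NoZeroDivisors E] (a : ℤ) (ha : (a : ZMod p) ≠ 0) :
    ∃ s : ℤ, (s = 1 ∨ s = -1) ∧ ∀ b : E, IsUnit (a - (1 - D.z 1) * b) →
      a - (1 - D.z 1) * b = s * D.z (s * D.ε b) := by
  obtain ⟨s, hs, c, hc⟩ : ∃ s : ℤ, (s = 1 ∨ s = -1) ∧ (D.m : ℤ) ∣ a - s := by
    rcases D.m_dvd a ha with h | h
    · exact ⟨1, .inl rfl, h⟩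
    · exact ⟨-1, .inr rfl, by simpa using h⟩
  refine ⟨s, hs, fun b hu => ?_⟩
  have hss : (s : E) * s = 1 := by rcases hs with rfl | rfl <;> simp
  have hssp : (s : ZMod p) * s = 1 := by rcases hs with rfl | rfl <;> simp
  have hsu : IsUnit (s : E) := IsUnit.of_mul_eq_one _ hss
  have hap : (a : ZMod p) = s := by
    have : ((a - s : ℤ) : ZMod p) = 0 :=
      (ZMod.intCast_zmod_eq_zero_iff_dvd _ _).2
        ((Int.natCast_dvd_natCast.2 D.p_dvd_m).trans ⟨c, hc⟩)
    rw [Int.cast_sub] at this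
    exact sub_eq_zero.1 this
  obtain ⟨k, hk⟩ := D.unit_eq (s * (a - (1 - D.z 1) * b)) (hsu.mul hu) (by
    rw [map_mul, map_sub, D.ε_uniformizer_mul, map_intCast, map_intCast, hap, sub_zero, hssp])
  obtain ⟨w, hw, hwk, -⟩ := D.exists_one_sub_z k
  obtain ⟨w', hw', hw0⟩ := D.m_eq
  have hcE : (a : E) - s = D.m * c := by exact_mod_cast congrArg (Int.cast : ℤ → E) hc
  -- Compare `a ≡ s` modulo `m` with `a - (1 - ζ) b = s ζ ^ k`. As `m` is divisible by `(1 - ζ)²`,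
  -- dividing by `1 - ζ` and reducing leaves `b ≡ s k`.
  have h1 : (1 - D.z 1) * (b - s * w) = (1 - D.z 1) * (w' * c) := by
    linear_combination s * hw + hcE + c * hw' - s * hk + (a - (1 - D.z 1) * b) * hss
  have h2 := congrArg D.ε (mul_left_cancel₀ D.uniformizer_ne_zero h1)
  rw [map_sub, map_mul, map_mul, hw0, hwk, zero_mul, map_intCast] at h2
  have h3 : (s : ZMod p) * D.ε b = k := by linear_combination s * h2 + k * hssp
  rw [h3]
  linear_combination s * hk - (a - (1 - D.z 1) * b) * hss

end CrystalData

/-! ### The Magnus property for translations -/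

namespace Crystal

variable {D : CrystalData p E J}

/-- The translations obtained from those of `x` by acting with the integral group ring of the point
group, to the precision that matters. -/
def translationOrbit (D : CrystalData p E J) (x : J → E) : Subgroup (Crystal D) where
  carrier := {y | y.pt = 0 ∧ ∃ (a : ℤ) (q : ZMod p × ZMod p) (b : J → E),
    ∀ j, D.ε (b j) = D.χ j q ∧ y.tr j = (a - (1 - D.z 1) * b j) * x j}
  one_mem' := ⟨rfl, 0, 0, 0, fun j => by simp⟩
  mul_mem' := by
    rintro y y' ⟨h, a, q, b, hb⟩ ⟨h', a', q', b', hb'⟩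
    refine ⟨by simp [h, h'], a + a', q + q', b + b', fun j => ⟨by simp [hb, hb'], ?_⟩⟩
    rw [tr_mul, h', map_zero, D.z_zero, (hb j).2, (hb' j).2]
    push_cast [Pi.add_apply]
    ring
  inv_mem' := by
    rintro y ⟨h, a, q, b, hb⟩
    refine ⟨by simp [h], -a, -q, -b, fun j => ⟨by simp [hb], ?_⟩⟩
    rw [tr_inv, h, map_zero, neg_zero, D.z_zero, (hb j).2]
    push_cast [Pi.neg_apply]
    ring

instance (x : J → E) : (translationOrbit D x).Normal where
  conj_mem := by
    rintro y ⟨h, a, q, b, hb⟩ g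
    have hg : g * y * g⁻¹ = g⁻¹⁻¹ * y * g⁻¹ := by group
    rw [hg]
    generalize g⁻¹ = g
    choose w hw hwk _ using D.exists_one_sub_z
    -- Conjugation multiplies block `j` by `1 - (1 - ζ) w`, where `w` has residue `χ j g.pt`; the
    -- witness is the expanded product with `a - (1 - ζ) b j`.
    refine ⟨by simp [h], a, q + a • g.pt,
      fun j => b j + a * w (D.χ j g.pt) - (1 - D.z 1) * w (D.χ j g.pt) * b j, fun j => ⟨?_, ?_⟩⟩
    · beta_reduce
      rw [mul_assoc, map_sub, D.ε_uniformizer_mul, map_add, map_mul, (hb j).1, hwk,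
        map_intCast, map_add, map_zsmul, zsmul_eq_mul, sub_zero]
    · rw [tr_conj, h, map_zero, D.z_zero, (hb j).2]
      linear_combination (-(a - (1 - D.z 1) * b j) * x j) * hw (D.χ j g.pt)

theorem mem_translationOrbit_of_mem {x y : Crystal D} (hx : x.pt = 0)
    (hy : y ∈ Subgroup.normalClosure {x}) : y ∈ translationOrbit D x.tr := by
  refine Subgroup.normalClosure_le_normal (N := translationOrbit D x.tr) ?_ hy
  rw [Set.singleton_subset_iff]
  exact ⟨hx, 1, 0, 0, fun j => by simp⟩

/-- The multipliers taking `x` to `y` and back are mutually inverse on the support of `x`. By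
`exists_sign` they equal `s * z (s * χ j q)` with `s` and `q` independent of `j`, which is the
effect of conjugation followed by a sign. -/
theorem magnus_translation [Fact p.Prime] [IsDomain E] {x y : Crystal D} (hx : x.pt = 0)
    (hy : y ∈ Subgroup.normalClosure {x}) (hxy : x ∈ Subgroup.normalClosure {y}) :
    IsConj x y ∨ IsConj x y⁻¹ := by
  obtain ⟨hy0, a, q, b, hb⟩ := mem_translationOrbit_of_mem hx hy
  obtain ⟨-, a', q', b', hb'⟩ := mem_translationOrbit_of_mem hy0 hxy
  by_cases h1 : x = 1
  · left
    have : y = 1 := ext' hy0 fun j => by rw [(hb j).2, h1]; simp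
    rw [h1, this]
  have hunit : ∀ j, x.tr j ≠ 0 → IsUnit (a - (1 - D.z 1) * b j) := fun j hj => by
    refine IsUnit.of_mul_eq_one (a' - (1 - D.z 1) * b' j) (mul_right_cancel₀ hj ?_)
    linear_combination (-(a' - (1 - D.z 1) * b' j)) * (hb j).2 - (hb' j).2
  obtain ⟨j, hj⟩ : ∃ j, x.tr j ≠ 0 := by
    by_contra! h
    exact h1 (ext' hx h)
  have ha : (a : ZMod p) ≠ 0 := by
    have := ((hunit j hj).map D.ε).ne_zero
    rwa [map_sub, D.ε_uniformizer_mul, sub_zero, map_intCast] at this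
  obtain ⟨s, hs, hsu⟩ := D.exists_sign a ha
  obtain ⟨g, hg⟩ := exists_pt_eq (D := D) (s • q)
  have hconj : ∀ j, y.tr j = s * (g⁻¹ * x * g).tr j := fun j => by
    rw [tr_conj, hg, hx, map_zero, D.z_zero, (hb j).2]
    by_cases hj : x.tr j = 0
    · simp [hj]
    · rw [hsu _ (hunit j hj), (hb j).1, map_zsmul, zsmul_eq_mul]
      ring
  have hC : IsConj x (g⁻¹ * x * g) := isConj_iff.2 ⟨g⁻¹, by group⟩
  rcases hs with rfl | rfl
  · left
    convert hC
    exact ext' (by simp [hx, hy0]) fun j => by simpa using hconj j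
  · right
    convert hC
    refine ext' (by simp [hx, hy0]) fun j => ?_
    rw [tr_inv, hy0, map_zero, neg_zero, D.z_zero, hconj j]
    simp

/-! ### The Magnus property for elements with nontrivial point part -/

/-- For `x` fixing block `i`, the normal subgroup generated by the commutators of `x`. -/
def commutatorLattice (D : CrystalData p E J) (i : J) (t : E) : Subgroup (Crystal D) where
  carrier := {y | y.pt = 0 ∧ ∃ (c : ZMod p) (e : J → E),
    (∀ j, D.ε (e j) = c ∧ y.tr j = (1 - D.z 1) * e j) ∧ t ∣ e i}
  one_mem' := ⟨rfl, 0, 0, fun j => by simp, by simp⟩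
  mul_mem' := by
    rintro y y' ⟨h, c, e, he, ht⟩ ⟨h', c', e', he', ht'⟩
    refine ⟨by simp [h, h'], c + c', e + e', fun j => ⟨by simp [he, he'], ?_⟩, dvd_add ht ht'⟩
    rw [tr_mul, h', map_zero, D.z_zero, (he j).2, (he' j).2, Pi.add_apply]
    ring
  inv_mem' := by
    rintro y ⟨h, c, e, he, ht⟩
    refine ⟨by simp [h], -c, -e, fun j => ⟨by simp [he], ?_⟩, (dvd_neg).2 ht⟩
    rw [tr_inv, h, map_zero, neg_zero, D.z_zero, (he j).2, Pi.neg_apply]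
    ring

instance (i : J) (t : E) : (commutatorLattice D i t).Normal where
  conj_mem := by
    rintro y ⟨h, c, e, he, ht⟩ g
    have hg : g * y * g⁻¹ = g⁻¹⁻¹ * y * g⁻¹ := by group
    rw [hg]
    generalize g⁻¹ = g
    refine ⟨by simp [h], c, fun j => D.z (D.χ j g.pt) * e j, fun j => ⟨?_, ?_⟩,
      ht.mul_left _⟩
    · rw [map_mul, D.ε_z, one_mul, (he j).1]
    · rw [tr_conj, h, map_zero, D.z_zero, (he j).2]
      ring

/-- The common residue is the determinant of the two point parts, by `det_eq`. In block `i` only the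
term carrying `x.tr i` survives, whence the divisibility. -/
theorem commutator_mem [NoZeroDivisors E] {x : Crystal D} {i : J} (hi : D.χ i x.pt = 0) (g : Crystal D) :
    x⁻¹ * (g⁻¹ * x * g) ∈ commutatorLattice D i (x.tr i) := by
  choose w hw hwk _ using D.exists_one_sub_z
  refine ⟨by simp, x.pt.1 * g.pt.2 - x.pt.2 * g.pt.1,
    fun j => g.tr j * w (D.χ j x.pt) - x.tr j * w (D.χ j g.pt), fun j => ⟨?_, ?_⟩, ?_⟩
  · rw [map_sub, map_mul, map_mul, hwk, hwk, g.ε_tr, x.ε_tr, D.det_eq]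
  · rw [tr_mul, tr_conj, tr_inv]
    have h1 : D.χ j (g⁻¹ * x * g).pt = D.χ j x.pt := by simp
    rw [h1]
    linear_combination (-x.tr j) * D.z_mul_neg (D.χ j x.pt) + g.tr j * hw (D.χ j x.pt)
      - x.tr j * hw (D.χ j g.pt)
  · have h0 : w (D.χ i x.pt) = 0 := by
      have := hw 0
      rw [D.z_zero, sub_self] at this
      rw [hi]
      exact (mul_eq_zero.1 this.symm).resolve_left D.uniformizer_ne_zero
    beta_reduce
    rw [h0, mul_zero, zero_sub, dvd_neg]
    exact dvd_mul_right _ _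

/-- By `commutator_mem`, `x` is central modulo the lattice, so its normal closure maps to a cyclic
group. -/
theorem exists_zpow_inv_mul_mem [NoZeroDivisors E] {x y : Crystal D} {i : J}
    (hi : D.χ i x.pt = 0) (hy : y ∈ Subgroup.normalClosure {x}) :
    ∃ n : ℤ, (x ^ n)⁻¹ * y ∈ commutatorLattice D i (x.tr i) := by
  let π := QuotientGroup.mk' (commutatorLattice D i (x.tr i))
  have hcomm : ∀ g, π (g⁻¹ * x * g) = π x := fun g =>
    (QuotientGroup.eq.2 (commutator_mem hi g)).symm
  have hnormal : ((Subgroup.zpowers (π x)).comap π).Normal := by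
    constructor
    intro a ha g
    obtain ⟨n, hn⟩ := Subgroup.mem_zpowers_iff.1 (Subgroup.mem_comap.1 ha)
    refine Subgroup.mem_comap.2 (Subgroup.mem_zpowers_iff.2 ⟨n, ?_⟩)
    have h1 := hcomm g⁻¹
    rw [map_mul, map_mul, map_inv, map_inv, inv_inv] at h1
    rw [map_mul, map_mul, map_inv, ← hn, ← conj_zpow, h1]
  have hmem := Subgroup.normalClosure_le_normal (N := (Subgroup.zpowers (π x)).comap π)
    (by simp [Subgroup.mem_zpowers]) hy
  obtain ⟨n, hn⟩ := Subgroup.mem_zpowers_iff.1 (Subgroup.mem_comap.1 hmem)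
  rw [← map_zpow] at hn
  exact ⟨n, QuotientGroup.eq.1 hn⟩

theorem zpow_mem_commutatorLattice [NoZeroDivisors E] {x : Crystal D} {i : J}
    (hi : D.χ i x.pt = 0) (hj : ∀ j, j ≠ i → D.χ j x.pt ≠ 0) {n : ℤ} (hn : (D.m : ℤ) ∣ n) :
    x ^ n ∈ commutatorLattice D i (x.tr i) := by
  obtain ⟨k, rfl⟩ := hn
  rw [zpow_mul]
  refine Subgroup.zpow_mem _ ?_ k
  obtain ⟨w, hw, hw0⟩ := D.m_eq
  have hpt : (x ^ (D.m : ℤ)).pt = 0 := by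
    obtain ⟨c, hc⟩ := D.p_dvd_m
    rw [zpow_natCast, pt_pow, hc]
    ext <;> simp
  classical
  refine ⟨hpt, 0, fun j => if j = i then w * x.tr i else 0, fun j => ?_, by simp⟩
  by_cases h : j = i
  · subst h
    refine ⟨by simp [hw0], ?_⟩
    beta_reduce
    rw [tr_zpow x hi, if_pos rfl]
    push_cast
    rw [hw]
    ring
  · refine ⟨by simp [h], ?_⟩
    -- The translation `x ^ m` commutes with `x`, which acts on block `j` without nonzero fixed
    -- points, so its coordinate there is zero.
    have h1 : (x ^ (D.m : ℤ) * x).tr j = (x * x ^ (D.m : ℤ)).tr j := by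
      rw [mul_zpow_self, mul_self_zpow]
    rw [tr_mul, tr_mul, hpt, map_zero, D.z_zero] at h1
    have h2 : (1 - D.z (D.χ j x.pt)) * (x ^ (D.m : ℤ)).tr j = 0 := by linear_combination -h1
    beta_reduce
    rw [if_neg h, mul_zero]
    exact (mul_eq_zero.1 h2).resolve_left (D.z_ne_one (hj j h))

theorem pt_ne_zero_of_mem {x y : Crystal D} (hx : x.pt ≠ 0)
    (hxy : x ∈ Subgroup.normalClosure {y}) : y.pt ≠ 0 := by
  intro hy
  refine hx ?_
  exact Subgroup.normalClosure_le_normal (N := (ptHom (D := D)).ker)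
    (by rw [Set.singleton_subset_iff]; exact hy) hxy

/-- In block `i` the coordinate of `y` is a unit multiple of that of `x`, the unit being a root of
unity `z k`. Any `q` with `χ i q = k` can be the point part of a conjugator. In the other blocks `1
- z (χ j x.pt)` is a uniformizer, so the conjugation equation can be solved for the translation
part. -/
theorem isConj_of_inv_mul_mem [IsDomain E] {x y : Crystal D} {i : J} (hx : x.pt ≠ 0)
    (hi : D.χ i x.pt = 0) (hj : ∀ j, j ≠ i → D.χ j x.pt ≠ 0)
    (hxy : x ∈ Subgroup.normalClosure {y})
    (hy : x⁻¹ * y ∈ commutatorLattice D i (x.tr i)) : IsConj x y := by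
  obtain ⟨h0, c, e, he, r, hr⟩ := hy
  have hpt : y.pt = x.pt := by
    rw [pt_mul, pt_inv, neg_add_eq_zero] at h0
    exact h0.symm
  have hytr : ∀ j, y.tr j = x.tr j + (1 - D.z 1) * e j := fun j => by
    have := (he j).2
    rw [tr_mul, tr_inv, hpt] at this
    linear_combination this + x.tr j * D.z_mul_neg (D.χ j x.pt)
  have hε := tr_ne_zero_of_pt_ne_zero hx hi
  have hxi : x.tr i ≠ 0 := fun h => hε (by simp [h])
  have hunit : IsUnit (1 + (1 - D.z 1) * r) := by
    have hyi : D.χ i y.pt = 0 := by rw [hpt, hi]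
    obtain ⟨n, h0', c', e', he', r', hr'⟩ := exists_zpow_inv_mul_mem hyi hxy
    have h1 := (he' i).2
    rw [tr_mul, tr_inv, hi, D.z_zero, pt_zpow, map_zsmul, hyi, tr_zpow y hyi, smul_zero, neg_zero,
      D.z_zero, hr'] at h1
    refine IsUnit.of_mul_eq_one (n + (1 - D.z 1) * r') (mul_left_cancel₀ hxi ?_)
    linear_combination (-(n + (1 - D.z 1) * r')) * hytr i
      - (n + (1 - D.z 1) * r') * (1 - D.z 1) * hr - h1
  obtain ⟨k, hk⟩ := D.unit_eq _ hunit (by rw [map_add, map_one, D.ε_uniformizer_mul, add_zero])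
  choose w hw hwk hwu using D.exists_one_sub_z
  have hrk : D.ε r = -k := by
    have h1 : (1 - D.z 1) * r = (1 - D.z 1) * -w k := by linear_combination hk - hw k
    rw [mul_left_cancel₀ D.uniformizer_ne_zero h1, map_neg, hwk]
  obtain ⟨q, hq⟩ := D.χ_surjective i k
  -- The residue `c`, read off in block `i`, gives the solutions in the other blocks the residue `f
  -- j q` required of a group element.
  have hc : c = x.pt.1 * q.2 - x.pt.2 * q.1 := by
    rw [← D.det_eq i x.pt q, hi, hq, ← (he i).1, hr, map_mul, hrk, x.ε_tr]
    ring
  have hex : ∀ j, ∃ t, D.ε t = D.f j q ∧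
      D.z (D.χ j q) * x.tr j + t * (1 - D.z (D.χ j x.pt)) = y.tr j := by
    intro j
    by_cases h : j = i
    · subst h
      refine ⟨((D.f j q).cast : ℤ), by simp, ?_⟩
      rw [hi, D.z_zero, hq, hytr, hr]
      linear_combination (-x.tr j) * hk
    · have hχ := hj j h
      obtain ⟨v, hv⟩ := hwu _ hχ
      refine ⟨((v⁻¹ : Eˣ) : E) * (x.tr j * w (D.χ j q) + e j), ?_, ?_⟩
      · have h1 : D.ε ((v⁻¹ : Eˣ) : E) * D.χ j x.pt = 1 := by
          rw [← hwk (D.χ j x.pt), ← hv, ← map_mul, Units.inv_mul, map_one]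
        rw [map_mul, map_add, map_mul, hwk, (he j).1, x.ε_tr, hc, ← D.det_eq j x.pt q]
        linear_combination (D.f j q) * h1
      · rw [hw (D.χ j x.pt), ← hv, hytr]
        linear_combination (-x.tr j) * hw (D.χ j q) +
          (1 - D.z 1) * (x.tr j * w (D.χ j q) + e j) * Units.inv_mul v
  choose t ht hty using hex
  refine isConj_iff.2 ⟨(⟨q, t, ht⟩ : Crystal D)⁻¹, ?_⟩
  rw [inv_inv]
  refine ext' (by simp [hpt]) fun j => ?_
  rw [tr_conj]
  exact hty j

theorem hasMagnusProperty [Fact p.Prime] [IsDomain E] : HasMagnusProperty (Crystal D) := by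
  intro x y hN
  have hy : y ∈ Subgroup.normalClosure {x} := hN ▸ Subgroup.subset_normalClosure rfl
  have hx : x ∈ Subgroup.normalClosure {y} := hN ▸ Subgroup.subset_normalClosure rfl
  by_cases hpt : x.pt = 0
  · exact magnus_translation hpt hy hx
  obtain ⟨i, hi, hj⟩ := D.exists_χ_eq_zero _ hpt
  obtain ⟨n, hn⟩ := exists_zpow_inv_mul_mem hi hy
  have hnp : (n : ZMod p) ≠ 0 := by
    intro h
    refine pt_ne_zero_of_mem hpt hx ?_
    have := hn.1
    rw [pt_mul, pt_inv, pt_zpow, neg_add_eq_zero] at this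
    rw [← this]
    ext <;> simp [h]
  -- Powers of `x` divisible by `m` lie in the lattice, so `x ^ n` can be replaced by `x` or `x⁻¹`.
  rcases D.m_dvd n hnp with h | h
  · left
    refine isConj_of_inv_mul_mem hpt hi hj hx ?_
    have h1 := mul_mem (zpow_mem_commutatorLattice hi hj h) hn
    have h2 : x ^ (n - 1) * ((x ^ n)⁻¹ * y) = x⁻¹ * y := by group
    rwa [h2] at h1
  · right
    refine isConj_of_inv_mul_mem hpt hi hj ?_ ?_
    · refine Subgroup.normalClosure_le_normal (Set.singleton_subset_iff.2 ?_) hx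
      exact inv_mem_iff.1 (Subgroup.subset_normalClosure rfl)
    · have h1 := mul_mem (Subgroup.Normal.conj_mem inferInstance _ (inv_mem hn) x⁻¹)
        (inv_mem (zpow_mem_commutatorLattice hi hj h))
      have h2 : x⁻¹ * ((x ^ n)⁻¹ * y)⁻¹ * x⁻¹⁻¹ * (x ^ (n + 1))⁻¹ = x⁻¹ * y⁻¹ := by group
      rwa [h2] at h1

end Crystal

/-! ### Recognizing a crystallographic group from generators and relations -/

theorem HasMagnusProperty.of_mulEquiv {G H : Type*} [Group G] [Group H] (e : G ≃* H)
    (hH : HasMagnusProperty H) : HasMagnusProperty G := by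
  intro x y hxy
  have h := congrArg (Subgroup.map e.toMonoidHom) hxy
  rw [Subgroup.map_normalClosure _ _ e.surjective, Subgroup.map_normalClosure _ _ e.surjective,
    Set.image_singleton, Set.image_singleton] at h
  refine (hH _ _ h).imp (fun h => ?_) fun h => ?_
  · simpa using MonoidHom.map_isConj e.symm.toMonoidHom h
  · simpa using MonoidHom.map_isConj e.symm.toMonoidHom h

namespace Crystal

variable {D : CrystalData p E J}

/-- The lattice of translations, with coordinates rescaled by `1 - ζ`. -/
def translation (D : CrystalData p E J) : (J → Multiplicative E) →* Crystal D where
  toFun a := ⟨0, fun j => (1 - D.z 1) * (a j).toAdd, fun j => by simp [D.ε_z]⟩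
  map_one' := ext' rfl fun j => by simp
  map_mul' a b := ext' (by simp) fun j => by
    simp only [tr_mul, map_zero, D.z_zero, Pi.mul_apply, toAdd_mul]
    ring

theorem translation_injective [IsDomain E] : Function.Injective (translation D) := by
  refine (injective_iff_map_eq_one _).2 fun a ha => ?_
  funext j
  have h : (1 - D.z 1) * (a j).toAdd = 0 := congrFun (congrArg Crystal.tr ha) j
  exact (mul_eq_zero.1 h).resolve_left D.uniformizer_ne_zero

theorem exists_translation_eq {g : Crystal D} (hg : g.pt = 0) : ∃ a, translation D a = g := by
  have h : ∀ j, ∃ b, g.tr j = (1 - D.z 1) * b := fun j =>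
    D.exists_of_ε_eq_zero _ (by rw [g.ε_tr, hg, map_zero])
  choose b hb using h
  exact ⟨fun j => Multiplicative.ofAdd (b j), ext' hg.symm fun j => (hb j).symm⟩

end Crystal

/-- If an element acts on the lattice through invertible scalars on the blocks, it normalizes the
lattice. -/
theorem mem_range_iff_conj_mem_range [Finite J] [DecidableEq J] {Γ : Type*} [Group Γ]
    (ι : (J → Multiplicative E) →* Γ) (u : Γ) (c : J → E) (hc : ∀ j, IsUnit (c j))
    (hu : ∀ j a, u⁻¹ * ι (Pi.mulSingle j (.ofAdd a)) * u = ι (Pi.mulSingle j (.ofAdd (c j * a))))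
    (g : Γ) : g ∈ ι.range ↔ u * g * u⁻¹ ∈ ι.range := by
  let scale (d : J → E) : (J → Multiplicative E) →* (J → Multiplicative E) :=
    { toFun := fun a j => .ofAdd (d j * (a j).toAdd)
      map_one' := by funext j; simp
      map_mul' := fun a b => by funext j; simp [mul_add] }
  have key : (MulAut.conj u⁻¹).toMonoidHom.comp ι = ι.comp (scale c) := by
    refine MonoidHom.pi_ext fun j a => ?_
    have h1 : scale c (Pi.mulSingle j a) = Pi.mulSingle j (.ofAdd (c j * a.toAdd)) := by
      funext k
      by_cases hk : k = j
      · subst hk; simp [scale]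
      · simp [scale, Pi.mulSingle_eq_of_ne hk]
    simpa [h1] using hu j a.toAdd
  have key' : ∀ a, u⁻¹ * ι a * u = ι (scale c a) := fun a => by
    simpa using DFunLike.congr_fun key a
  choose d hd using fun j => (hc j).exists_right_inv
  constructor
  · rintro ⟨a, rfl⟩
    have h2 : scale c (scale d a) = a := by
      funext j
      simp [scale, ← mul_assoc, hd]
    refine ⟨scale d a, ?_⟩
    rw [← h2, ← key', h2]
    group
  · rintro ⟨a, ha⟩
    refine ⟨scale c a, ?_⟩
    rw [← key', ha]
    group

namespace Crystal

variable {D : CrystalData p E J}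

/-- A group generated by `u`, `v` and a lattice on which they act as in a crystallographic group is
isomorphic to that group. -/
theorem bijective_of_lattice [NeZero p] [IsDomain E] {Γ : Type*} [Group Γ] (φ : Γ →* Crystal D)
    (ι : (J → Multiplicative E) →* Γ) (hφ : ∀ a, φ (ι a) = translation D a) (u v : Γ)
    (hu : (φ u).pt = (1, 0)) (hv : (φ v).pt = (0, 1))
    (hun : ∀ g, g ∈ ι.range ↔ u * g * u⁻¹ ∈ ι.range)
    (hvn : ∀ g, g ∈ ι.range ↔ v * g * v⁻¹ ∈ ι.range)
    (hup : u ^ p ∈ ι.range) (hvp : v ^ p ∈ ι.range) (huv : u⁻¹ * v⁻¹ * u * v ∈ ι.range)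
    (hgen : Subgroup.closure ({u, v} ∪ (ι.range : Set Γ)) = ⊤) : Function.Bijective φ := by
  have hnorm : ι.range.Normal := by
    rw [← Subgroup.normalizer_eq_top_iff, eq_top_iff, ← hgen, Subgroup.closure_le]
    rintro g ((rfl | rfl) | hg)
    · exact Subgroup.mem_normalizer_iff.2 hun
    · exact Subgroup.mem_normalizer_iff.2 hvn
    · exact Subgroup.le_normalizer hg
  let π := QuotientGroup.mk' ι.range
  have hcomm : Commute (π u) (π v) := by
    have h : π (u⁻¹ * v⁻¹ * u * v) = 1 := (QuotientGroup.eq_one_iff _).2 huv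
    simp only [map_mul, map_inv] at h
    calc π u * π v = π v * π u * ((π u)⁻¹ * (π v)⁻¹ * π u * π v) := by group
      _ = π v * π u := by rw [h, mul_one]
  let S : Subgroup Γ :=
    { carrier := {g | ∃ m n : ℤ, π g = π u ^ m * π v ^ n}
      one_mem' := ⟨0, 0, by simp⟩
      mul_mem' := by
        rintro a b ⟨m, n, h⟩ ⟨m', n', h'⟩
        refine ⟨m + m', n + n', ?_⟩
        rw [map_mul, h, h', zpow_add, zpow_add, mul_assoc, ← mul_assoc (π v ^ n),
          (hcomm.zpow_zpow m' n).eq.symm]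
        group
      inv_mem' := by
        rintro a ⟨m, n, h⟩
        refine ⟨-m, -n, ?_⟩
        rw [map_inv, h, mul_inv_rev, ← zpow_neg, ← zpow_neg, (hcomm.zpow_zpow (-m) (-n)).eq] }
  -- Modulo the normal lattice the group is abelian and generated by `u` and `v`, so every element
  -- is `u ^ m * v ^ n` times a lattice element.
  have hS : ∀ g, g ∈ S := by
    suffices h : S = ⊤ by simp [h]
    rw [eq_top_iff, ← hgen, Subgroup.closure_le]
    rintro g ((rfl | rfl) | hg)
    · exact ⟨1, 0, by simp⟩
    · exact ⟨0, 1, by simp⟩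
    · refine ⟨0, 0, ?_⟩
      rw [zpow_zero, zpow_zero, mul_one]
      exact (QuotientGroup.eq_one_iff g).2 hg
  have hpt : ∀ m n : ℤ, (φ (u ^ m * v ^ n)).pt = ((m : ZMod p), (n : ZMod p)) := fun m n => by
    rw [map_mul, map_zpow, map_zpow, pt_mul, pt_zpow, pt_zpow, hu, hv]
    simp
  have hpow : ∀ (w : Γ), w ^ p ∈ ι.range → ∀ n : ℤ, (n : ZMod p) = 0 → w ^ n ∈ ι.range := by
    intro w hw n hn
    obtain ⟨k, rfl⟩ := (ZMod.intCast_zmod_eq_zero_iff_dvd _ _).1 hn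
    rw [zpow_mul, zpow_natCast]
    exact zpow_mem hw k
  constructor
  · refine (injective_iff_map_eq_one φ).2 fun g hg => ?_
    obtain ⟨m, n, hmn⟩ := hS g
    rw [← map_zpow, ← map_zpow, ← map_mul] at hmn
    obtain ⟨a, ha⟩ := QuotientGroup.eq.1 hmn.symm
    have hga : g = u ^ m * v ^ n * ι a := by rw [ha, mul_inv_cancel_left]
    have h0 := congrArg Crystal.pt hg
    rw [hga, map_mul, pt_mul, hpt, hφ] at h0
    have h1 : ((m : ZMod p), (n : ZMod p)) = 0 := by simpa [translation] using h0
    obtain ⟨b, hb⟩ : g ∈ ι.range := by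
      rw [hga]
      exact mul_mem (mul_mem (hpow u hup m (congrArg Prod.fst h1))
        (hpow v hvp n (congrArg Prod.snd h1))) ⟨a, rfl⟩
    rw [← hb, hφ] at hg
    rw [← hb, (injective_iff_map_eq_one _).1 translation_injective b hg, map_one]
  · intro c
    let g := u ^ (c.pt.1.cast : ℤ) * v ^ (c.pt.2.cast : ℤ)
    have hg : (φ g).pt = c.pt := by rw [hpt]; simp
    obtain ⟨a, ha⟩ := exists_translation_eq (g := (φ g)⁻¹ * c) (by simp [hg])
    exact ⟨g * ι a, by rw [map_mul, hφ, ha, mul_inv_cancel_left]⟩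

end Crystal

theorem isFGTorsionFreeResiduallyFinite_and_hasMagnusProperty_of_mulEquiv_crystal [Fact p.Prime]
    [IsDomain E] [CharZero E] {D : CrystalData p E J} {G : Type*} [Group G] (hG : Group.FG G)
    (e : G ≃* Crystal D) : IsFGTorsionFreeResiduallyFinite G ∧ HasMagnusProperty G := by
  refine ⟨⟨hG, fun g hg => ?_, ?_⟩, .of_mulEquiv e Crystal.hasMagnusProperty⟩
  · exact (map_eq_one_iff e e.injective).1
      (Crystal.eq_one_of_isOfFinOrder _ (e.toMonoidHom.isOfFinOrder hg))
  · have := Crystal.residuallyFinite (D := D)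
    rw [Group.residuallyFinite_iff_forall_finiteIndexNormalSubgroup] at this ⊢
    intro g hg
    refine (map_eq_one_iff e e.injective).1 (this _ fun K => ?_)
    exact hg (K.comap e.toMonoidHom)

theorem PresentedGroup.fg {α : Type*} [Finite α] (rels : Set (FreeGroup α)) :
    Group.FG (PresentedGroup rels) :=
  Group.fg_of_surjective (PresentedGroup.mk_surjective rels)

/-! ### Eisenstein integers and the data of the two groups -/

open scoped QuadraticAlgebra

instance : CharZero (QuadraticAlgebra ℤ (-1) (-1)) :=
  ⟨fun a b h => by simpa using congrArg QuadraticAlgebra.re h⟩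

/-- The Eisenstein integers. -/
abbrev Eisenstein : Type := QuadraticAlgebra ℤ (-1) (-1)

namespace Eisenstein

theorem norm_eq (a : Eisenstein) : a.norm = a.re ^ 2 - a.re * a.im + a.im ^ 2 := by
  rw [QuadraticAlgebra.norm_def]; ring

instance : NoZeroDivisors Eisenstein where
  eq_zero_or_eq_zero_of_mul_eq_zero {a b} h := by
    have key : ∀ c : Eisenstein, c.norm = 0 → c = 0 := fun c hc => by
      rw [norm_eq] at hc
      have h1 : c.im = 0 := by nlinarith [sq_nonneg (2 * c.re - c.im), sq_nonneg c.im]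
      have h2 : c.re = 0 := by nlinarith [sq_nonneg (2 * c.im - c.re), sq_nonneg c.re]
      exact QuadraticAlgebra.ext h2 h1
    have h1 : a.norm * b.norm = 0 := by rw [← map_mul, h, QuadraticAlgebra.norm_zero]
    exact (mul_eq_zero.1 h1).imp (key a) (key b)

instance : IsDomain Eisenstein := NoZeroDivisors.to_isDomain _

/-- Reduction of the coordinates modulo `n`. -/
def reduce (n : ℕ) : Eisenstein →+* QuadraticAlgebra (ZMod n) (-1) (-1) where
  toFun a := ⟨a.re, a.im⟩
  map_one' := by ext <;> simp
  map_zero' := by ext <;> simp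
  map_add' a b := by ext <;> simp
  map_mul' a b := by ext <;> simp

/-- Reduction modulo the prime `1 - ω` above `3`. -/
def residue : Eisenstein →+* ZMod 3 where
  toFun a := a.re + a.im
  map_one' := by simp
  map_zero' := by simp
  map_add' a b := by simp; ring
  map_mul' a b := by
    have h3 : (3 : ZMod 3) = 0 := rfl
    simp
    linear_combination (-(a.im : ZMod 3) * b.im) * h3

/-- The cube roots of unity. -/
def rootOfUnity : ZMod 3 → Eisenstein := ![1, ⟨0, 1⟩, ⟨-1, -1⟩]

end Eisenstein

open Eisenstein in
/-- The data of `G_3`. -/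
def g3Data : CrystalData 3 Eisenstein (Fin 4) where
  z := rootOfUnity
  z_zero := rfl
  z_add := by decide
  ε := residue
  ε_z := by decide
  exists_of_ε_eq_zero a ha := by
    have h : ((a.re + a.im : ℤ) : ZMod 3) = 0 := by push_cast; exact ha
    obtain ⟨c, hc⟩ := (ZMod.intCast_zmod_eq_zero_iff_dvd _ _).1 h
    -- The quotient by `1 - ω` when `re + im = 3 * c`.
    refine ⟨⟨a.re - c, c⟩, ?_⟩
    ext <;> simp [rootOfUnity]
    push_cast at hc
    linear_combination hc
  uniformizer_ne_zero := by decide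
  exists_one_sub_z k := by
    fin_cases k
    · exact ⟨0, by decide, rfl, fun h => (h rfl).elim⟩
    · exact ⟨1, by decide, rfl, fun _ => isUnit_one⟩
    · exact ⟨⟨1, 1⟩, by decide, rfl, fun _ =>
        IsUnit.of_mul_eq_one (⟨0, -1⟩ : Eisenstein) (by decide)⟩
  m := 3
  p_dvd_m := dvd_rfl
  m_eq := ⟨⟨2, 1⟩, by decide, by decide⟩
  m_dvd n hn := by
    rw [Ne, ZMod.intCast_zmod_eq_zero_iff_dvd] at hn
    omega
  unit_eq u hu hε := by
    have h1 := Int.isUnit_iff.1 (QuadraticAlgebra.isUnit_iff_norm_isUnit.1 hu)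
    rw [norm_eq] at h1
    obtain ⟨r, i⟩ := u
    have h2 : r ^ 2 - r * i + i ^ 2 = 1 := by
      rcases h1 with h | h
      · exact h
      · simp only at h; nlinarith [sq_nonneg (2 * r - i), sq_nonneg i]
    have hi : -1 ≤ i ∧ i ≤ 1 := by constructor <;> nlinarith [sq_nonneg (2 * r - i)]
    have hr : -1 ≤ r ∧ r ≤ 1 := by constructor <;> nlinarith [sq_nonneg (2 * i - r)]
    obtain ⟨hi1, hi2⟩ := hi
    obtain ⟨hr1, hr2⟩ := hr
    interval_cases i <;> interval_cases r <;> revert h2 hε <;> decide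
  exists_finite_quotient a ha := by
    let n := a.re.natAbs + a.im.natAbs + 1
    have : Finite (QuadraticAlgebra (ZMod n) (-1) (-1)) :=
      Finite.of_equiv _ (QuadraticAlgebra.equivProd _ _).symm
    refine ⟨QuadraticAlgebra (ZMod n) (-1) (-1), inferInstance, this, reduce n, fun h => ha ?_⟩
    have h1 : ((a.re : ℤ) : ZMod n) = 0 := congrArg QuadraticAlgebra.re h
    have h2 : ((a.im : ℤ) : ZMod n) = 0 := congrArg QuadraticAlgebra.im h
    rw [ZMod.intCast_zmod_eq_zero_iff_dvd] at h1 h2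
    exact QuadraticAlgebra.ext (Int.eq_zero_of_abs_lt_dvd h1 (by rw [Int.abs_eq_natAbs]; omega))
      (Int.eq_zero_of_abs_lt_dvd h2 (by rw [Int.abs_eq_natAbs]; omega))
  χ := ![.snd _ _, .fst _ _, .fst _ _ + .snd _ _, .fst _ _ - .snd _ _]
  f := ![-.fst _ _, .snd _ _, .snd _ _, .snd _ _]
  det_eq j a b := by fin_cases j <;> simp <;> ring
  χ_surjective := by decide
  exists_χ_eq_zero := by decide

/-- The data of the Hantzsche-Wendt group. -/
def hwData : CrystalData 2 ℤ (Fin 3) where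
  z := ![1, -1]
  z_zero := rfl
  z_add := by decide
  ε := Int.castRingHom _
  ε_z := by decide
  exists_of_ε_eq_zero a ha := (ZMod.intCast_zmod_eq_zero_iff_dvd _ _).1 ha
  uniformizer_ne_zero := by decide
  exists_one_sub_z k := by
    fin_cases k
    · exact ⟨0, by decide, rfl, fun h => (h rfl).elim⟩
    · exact ⟨1, by decide, rfl, fun _ => isUnit_one⟩
  -- Here `1 - ζ = 2`, so `2` is not divisible by its square and `4` is needed.
  m := 4
  p_dvd_m := by decide
  m_eq := ⟨2, by decide, by decide⟩
  m_dvd n hn := by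
    rw [Ne, ZMod.intCast_zmod_eq_zero_iff_dvd] at hn
    omega
  unit_eq u hu _ := by
    rcases Int.isUnit_iff.1 hu with rfl | rfl
    · exact ⟨0, rfl⟩
    · exact ⟨1, rfl⟩
  exists_finite_quotient a ha := by
    let n := a.natAbs + 1
    refine ⟨ZMod n, inferInstance, inferInstance, Int.castRingHom _, fun h => ha ?_⟩
    have h1 := (ZMod.intCast_zmod_eq_zero_iff_dvd a n).1 h
    exact Int.eq_zero_of_abs_lt_dvd h1 (by rw [Int.abs_eq_natAbs]; omega)
  χ := ![.snd _ _, .fst _ _, .fst _ _ + .snd _ _]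
  f := ![.fst _ _, .snd _ _, .snd _ _]
  det_eq := by decide
  χ_surjective := by decide
  exists_χ_eq_zero := by decide

/-! ### The Hantzsche–Wendt presentation -/

theorem commute_sq_of_conj_eq_inv {G : Type*} [Group G] {g h : G} (hg : h⁻¹ * g * h = g⁻¹) :
    Commute (h ^ 2) g := by
  have h1 : g * h = h * g⁻¹ := by rw [← hg]; group
  have h2 : h * g = g⁻¹ * h := by rw [eq_inv_mul_iff_mul_eq, ← mul_assoc, h1, inv_mul_cancel_right]
  change h ^ 2 * g = g * h ^ 2
  rw [pow_two, mul_assoc, h2, ← mul_assoc, ← mul_assoc, h1]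

namespace HantzscheWendtGroup

/-- The first generator. -/
def x : HantzscheWendtGroup := PresentedGroup.of HWGen.x

/-- The second generator. -/
def y : HantzscheWendtGroup := PresentedGroup.of HWGen.y

theorem conj_y_sq : x⁻¹ * y ^ 2 * x = y ^ (-2 : ℤ) := by
  have h : PresentedGroup.mk hwRels _ = 1 := PresentedGroup.one_of_mem (.inl rfl)
  exact mul_inv_eq_one.1 h

theorem conj_x_sq : y⁻¹ * x ^ 2 * y = x ^ (-2 : ℤ) := by
  have h : PresentedGroup.mk hwRels _ = 1 := PresentedGroup.one_of_mem (.inr rfl)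
  exact mul_inv_eq_one.1 h

/-- The homomorphism determined by images of the generators. -/
def lift {G : Type*} [Group G] (a b : G) (h1 : a⁻¹ * b ^ 2 * a = b ^ (-2 : ℤ))
    (h2 : b⁻¹ * a ^ 2 * b = a ^ (-2 : ℤ)) : HantzscheWendtGroup →* G :=
  PresentedGroup.toGroup (f := fun g => HWGen.casesOn g a b) (by
    rintro r (rfl | rfl)
    · rw [map_mul, map_inv, mul_inv_eq_one]
      simpa [rightConj] using h1
    · rw [map_mul, map_inv, mul_inv_eq_one]
      simpa [rightConj] using h2)

section

variable {G : Type*} [Group G] {a b : G} (h1 : a⁻¹ * b ^ 2 * a = b ^ (-2 : ℤ))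
  (h2 : b⁻¹ * a ^ 2 * b = a ^ (-2 : ℤ))

@[simp] theorem lift_x : lift a b h1 h2 x = a := PresentedGroup.toGroup.of _

@[simp] theorem lift_y : lift a b h1 h2 y = b := PresentedGroup.toGroup.of _

end

theorem closure_eq_top : Subgroup.closure {x, y} = ⊤ := by
  rw [eq_top_iff, ← PresentedGroup.closure_range_of]
  refine Subgroup.closure_mono ?_
  rintro _ ⟨_ | _, rfl⟩
  · exact .inl rfl
  · exact .inr rfl

/-- The generators of the lattice. -/
def latticeGen : Fin 3 → HantzscheWendtGroup := ![x ^ 2, y ^ 2, (x * y) ^ 2]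

theorem conj_inv_y_sq : x * (y ^ 2)⁻¹ * x⁻¹ = y ^ 2 := by
  rw [← zpow_ofNat y 2, ← zpow_neg, ← conj_y_sq]; group

theorem conj_inv_x_sq : y * x ^ 2 * y⁻¹ = x ^ (-2 : ℤ) := by
  have h : y * (x ^ 2)⁻¹ * y⁻¹ = x ^ 2 := by
    rw [← zpow_ofNat x 2, ← zpow_neg, ← conj_x_sq]; group
  rw [zpow_neg, zpow_ofNat, eq_inv_iff_mul_eq_one]
  nth_rw 2 [← h]
  group

theorem conj_x_mul_sq : x⁻¹ * (x * y) ^ 2 * x = ((x * y) ^ 2)⁻¹ := by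
  refine eq_inv_of_mul_eq_one_left ?_
  calc x⁻¹ * (x * y) ^ 2 * x * (x * y) ^ 2
      = y * x * (y * x ^ 2 * y⁻¹) * y ^ 2 * x * y := by simp only [pow_two]; group
    _ = y * (x⁻¹ * y ^ 2 * x) * y := by rw [conj_inv_x_sq]; group
    _ = 1 := by rw [conj_y_sq]; group

theorem conj_y_mul_sq : y⁻¹ * (x * y) ^ 2 * y = ((x * y) ^ 2)⁻¹ := by
  refine eq_inv_of_mul_eq_one_left ?_
  calc y⁻¹ * (x * y) ^ 2 * y * (x * y) ^ 2
      = y⁻¹ * x * y * x ^ 2 * (x⁻¹ * y ^ 2 * x) * y * x * y := by simp only [pow_two]; group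
    _ = y⁻¹ * x * (y * x ^ 2 * y⁻¹) * x * y := by rw [conj_y_sq]; group
    _ = 1 := by rw [conj_inv_x_sq]; group

theorem conj_x_latticeGen (j : Fin 3) :
    x⁻¹ * latticeGen j * x = latticeGen j ^ (hwData.z (hwData.χ j (1, 0))) := by
  fin_cases j
  · change x⁻¹ * x ^ 2 * x = (x ^ 2) ^ (1 : ℤ)
    group
  · change x⁻¹ * y ^ 2 * x = (y ^ 2) ^ (-1 : ℤ)
    rw [conj_y_sq]; group
  · change x⁻¹ * (x * y) ^ 2 * x = ((x * y) ^ 2) ^ (-1 : ℤ)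
    rw [conj_x_mul_sq, zpow_neg_one]

theorem conj_y_latticeGen (j : Fin 3) :
    y⁻¹ * latticeGen j * y = latticeGen j ^ (hwData.z (hwData.χ j (0, 1))) := by
  fin_cases j
  · change y⁻¹ * x ^ 2 * y = (x ^ 2) ^ (-1 : ℤ)
    rw [conj_x_sq]; group
  · change y⁻¹ * y ^ 2 * y = (y ^ 2) ^ (1 : ℤ)
    group
  · change y⁻¹ * (x * y) ^ 2 * y = ((x * y) ^ 2) ^ (-1 : ℤ)
    rw [conj_y_mul_sq, zpow_neg_one]

theorem latticeGen_commute (i j : Fin 3) : Commute (latticeGen i) (latticeGen j) := by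
  have hab : Commute (x ^ 2) (y ^ 2) :=
    commute_sq_of_conj_eq_inv (by rw [conj_y_sq, zpow_neg, zpow_ofNat])
  have hac : Commute (x ^ 2) ((x * y) ^ 2) := commute_sq_of_conj_eq_inv conj_x_mul_sq
  have hbc : Commute (y ^ 2) ((x * y) ^ 2) := commute_sq_of_conj_eq_inv conj_y_mul_sq
  fin_cases i <;> fin_cases j
  exacts [.refl _, hab, hac, hab.symm, .refl _, hbc, hac.symm, hbc.symm, .refl _]

/-- The embedding of the lattice. -/
def lattice : (Fin 3 → Multiplicative ℤ) →* HantzscheWendtGroup :=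
  MonoidHom.noncommPiCoprod (fun j => zpowersHom _ (latticeGen j))
    fun i j _ m n => (latticeGen_commute i j).zpow_zpow m.toAdd n.toAdd

theorem lattice_mulSingle (j : Fin 3) (n : ℤ) :
    lattice (Pi.mulSingle j (.ofAdd n)) = latticeGen j ^ n :=
  MonoidHom.noncommPiCoprod_mulSingle _ _ _

/-- The map to the concrete crystallographic group. -/
def toCrystal : HantzscheWendtGroup →* Crystal hwData :=
  lift ⟨(1, 0), ![1, 0, 0], by decide⟩ ⟨(0, 1), ![0, 1, 1], by decide⟩
    (Crystal.ext' (by decide) (by decide)) (Crystal.ext' (by decide) (by decide))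

theorem toCrystal_lattice (a : Fin 3 → Multiplicative ℤ) :
    toCrystal (lattice a) = Crystal.translation hwData a := by
  refine DFunLike.congr_fun (f := toCrystal.comp lattice) (MonoidHom.pi_ext fun j n => ?_) a
  refine DFunLike.congr_fun (f := (toCrystal.comp lattice).comp (MonoidHom.mulSingle (fun _ => Multiplicative ℤ) j))
    (g := (Crystal.translation hwData).comp (MonoidHom.mulSingle (fun _ => Multiplicative ℤ) j))
    (MonoidHom.ext_mint ?_) n
  change toCrystal (lattice (Pi.mulSingle j (.ofAdd 1))) = _
  rw [lattice_mulSingle, zpow_one]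
  fin_cases j
  · change toCrystal (x ^ 2) = _
    rw [toCrystal, map_pow, lift_x]
    exact Crystal.ext' (by decide) (by decide)
  · change toCrystal (y ^ 2) = _
    rw [toCrystal, map_pow, lift_y]
    exact Crystal.ext' (by decide) (by decide)
  · change toCrystal ((x * y) ^ 2) = _
    rw [toCrystal, map_pow, map_mul, lift_x, lift_y]
    exact Crystal.ext' (by decide) (by decide)

theorem latticeGen_mem_range (j : Fin 3) : latticeGen j ∈ lattice.range :=
  ⟨_, (lattice_mulSingle j 1).trans (zpow_one _)⟩

theorem toCrystal_bijective : Function.Bijective toCrystal := by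
  refine Crystal.bijective_of_lattice toCrystal lattice toCrystal_lattice x y ?_ ?_
    (mem_range_iff_conj_mem_range lattice x (fun j => hwData.z (hwData.χ j (1, 0)))
      (fun j => ?_) fun j a => ?_)
    (mem_range_iff_conj_mem_range lattice y (fun j => hwData.z (hwData.χ j (0, 1)))
      (fun j => ?_) fun j a => ?_)
    (latticeGen_mem_range 0) (latticeGen_mem_range 1) ?_ ?_
  · rw [toCrystal, lift_x]
  · rw [toCrystal, lift_y]
  · exact IsUnit.of_mul_eq_one _ (hwData.z_mul_neg _)
  · rw [lattice_mulSingle, lattice_mulSingle, zpow_mul, ← conj_x_latticeGen]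
    simpa using (conj_zpow (a := x⁻¹) (b := latticeGen j) (i := a)).symm
  · exact IsUnit.of_mul_eq_one _ (hwData.z_mul_neg _)
  · rw [lattice_mulSingle, lattice_mulSingle, zpow_mul, ← conj_y_latticeGen]
    simpa using (conj_zpow (a := y⁻¹) (b := latticeGen j) (i := a)).symm
  -- As `x` inverts `y ^ 2`, the commutator is `x⁻² y² (xy)²`, a lattice element.
  · have h : x⁻¹ * y⁻¹ * x * y = (x ^ 2)⁻¹ * (x * (y ^ 2)⁻¹ * x⁻¹) * (x * y) ^ 2 := by
      simp only [pow_two]; group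
    rw [h, conj_inv_y_sq]
    exact mul_mem (mul_mem (inv_mem (latticeGen_mem_range 0)) (latticeGen_mem_range 1))
      (latticeGen_mem_range 2)
  · rw [eq_top_iff, ← closure_eq_top]
    exact Subgroup.closure_mono Set.subset_union_left

theorem properties : IsFGTorsionFreeResiduallyFinite HantzscheWendtGroup ∧
    HasMagnusProperty HantzscheWendtGroup :=
  have : Finite HWGen := Finite.of_surjective (fun b : Bool => if b then HWGen.x else HWGen.y)
    fun g => by cases g; exacts [⟨true, rfl⟩, ⟨false, rfl⟩]
  isFGTorsionFreeResiduallyFinite_and_hasMagnusProperty_of_mulEquiv_crystal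
    (PresentedGroup.fg _) (MulEquiv.ofBijective toCrystal toCrystal_bijective)

end HantzscheWendtGroup

/-! ### The presentation of `G_3` -/

namespace Eisenstein

/-- The homomorphism from the additive group of the Eisenstein integers given by the images of `1`
and `ω`. -/
def toGroup {G : Type*} [Group G] {a b : G} (h : Commute a b) : Multiplicative Eisenstein →* G where
  toFun t := a ^ t.toAdd.re * b ^ t.toAdd.im
  map_one' := by simp
  map_mul' s t := by
    simp only [toAdd_mul, QuadraticAlgebra.re_add, QuadraticAlgebra.im_add, zpow_add]
    rw [mul_assoc, ← mul_assoc (a ^ t.toAdd.re), (h.zpow_zpow _ _).eq]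
    group

theorem monoidHom_ext {G : Type*} [Group G] {f g : Multiplicative Eisenstein →* G}
    (h1 : f (.ofAdd 1) = g (.ofAdd 1)) (h2 : f (.ofAdd ⟨0, 1⟩) = g (.ofAdd ⟨0, 1⟩)) : f = g := by
  refine MonoidHom.ext fun t => ?_
  have h : t = Multiplicative.ofAdd (1 : Eisenstein) ^ t.toAdd.re *
      Multiplicative.ofAdd (⟨0, 1⟩ : Eisenstein) ^ t.toAdd.im := by
    apply Multiplicative.toAdd.injective
    ext <;> simp
  rw [h]
  simp only [map_mul, map_zpow, h1, h2]

end Eisenstein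

namespace GroupG3

/-- The first generator of the point group. -/
def u : GroupG3 := PresentedGroup.of G3Gen.u

/-- The second generator of the point group. -/
def v : GroupG3 := PresentedGroup.of G3Gen.v

/-- The generators of the lattice. -/
def lat (a : LatticeGen) : GroupG3 := PresentedGroup.of (G3Gen.lat a)

theorem lat_commute (a b : LatticeGen) : Commute (lat a) (lat b) := by
  have h : PresentedGroup.mk g3Rels _ = 1 :=
    PresentedGroup.one_of_mem (.inl (.inl (.inl ⟨a, b, rfl⟩)))
  replace h : (lat a)⁻¹ * (lat b)⁻¹ * lat a * lat b = 1 := h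
  change lat a * lat b = lat b * lat a
  calc lat a * lat b = lat b * lat a * ((lat a)⁻¹ * (lat b)⁻¹ * lat a * lat b) := by group
    _ = _ := by rw [h, mul_one]

theorem conj_u (a : LatticeGen) :
    u⁻¹ * lat a * u = PresentedGroup.mk g3Rels (conjUWord a) := by
  have h : PresentedGroup.mk g3Rels _ = 1 := PresentedGroup.one_of_mem (.inl (.inl (.inr ⟨a, rfl⟩)))
  exact mul_inv_eq_one.1 h

theorem conj_v (a : LatticeGen) :
    v⁻¹ * lat a * v = PresentedGroup.mk g3Rels (conjVWord a) := by
  have h : PresentedGroup.mk g3Rels _ = 1 := PresentedGroup.one_of_mem (.inl (.inr ⟨a, rfl⟩))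
  exact mul_inv_eq_one.1 h

theorem u_pow : u ^ 3 = lat .eInf ^ (-2 : ℤ) * (lat .eInf')⁻¹ := by
  have h : PresentedGroup.mk g3Rels _ = 1 := PresentedGroup.one_of_mem (.inr (.inl rfl))
  exact mul_inv_eq_one.1 h

theorem v_pow : v ^ 3 = lat .e0 ^ 2 * lat .e0' := by
  have h : PresentedGroup.mk g3Rels _ = 1 := PresentedGroup.one_of_mem (.inr (.inr (.inl rfl)))
  exact mul_inv_eq_one.1 h

theorem comm_u_v : u⁻¹ * v⁻¹ * u * v = lat .eInf * lat .e0 * lat .e1 * lat .e2 := by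
  have h : PresentedGroup.mk g3Rels _ = 1 := PresentedGroup.one_of_mem (.inr (.inr (.inr rfl)))
  exact mul_inv_eq_one.1 h

theorem closure_eq_top : Subgroup.closure ({u, v} ∪ Set.range lat) = ⊤ := by
  rw [eq_top_iff, ← PresentedGroup.closure_range_of]
  refine Subgroup.closure_mono ?_
  rintro _ ⟨_ | _ | a, rfl⟩
  · exact .inl (.inl rfl)
  · exact .inl (.inr rfl)
  · exact .inr ⟨a, rfl⟩

/-- The generator of each block corresponding to `1`. -/
def gen : Fin 4 → LatticeGen := ![.eInf, .e0, .e1, .e2]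

/-- The generator of each block corresponding to `ω`. -/
def gen' : Fin 4 → LatticeGen := ![.eInf', .e0', .e1', .e2']

/-- The embedding of one block of the lattice. -/
def block (j : Fin 4) : Multiplicative Eisenstein →* GroupG3 :=
  Eisenstein.toGroup (lat_commute (gen j) (gen' j))

theorem block_apply (j : Fin 4) (t : Eisenstein) :
    block j (.ofAdd t) = lat (gen j) ^ t.re * lat (gen' j) ^ t.im := rfl

/-- The embedding of the lattice. -/
def lattice : (Fin 4 → Multiplicative Eisenstein) →* GroupG3 :=
  MonoidHom.noncommPiCoprod block fun _ _ _ _ _ =>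
    (((lat_commute _ _).zpow_zpow _ _).mul_right ((lat_commute _ _).zpow_zpow _ _)).mul_left
      (((lat_commute _ _).zpow_zpow _ _).mul_right ((lat_commute _ _).zpow_zpow _ _))

theorem lattice_mulSingle (j : Fin 4) (t : Multiplicative Eisenstein) :
    lattice (Pi.mulSingle j t) = block j t :=
  MonoidHom.noncommPiCoprod_mulSingle _ _ _

theorem conj_block {w : GroupG3} {j : Fin 4} {c : Eisenstein}
    (h1 : w⁻¹ * lat (gen j) * w = block j (.ofAdd c))
    (h2 : w⁻¹ * lat (gen' j) * w = block j (.ofAdd (c * ⟨0, 1⟩))) (t : Eisenstein) :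
    w⁻¹ * block j (.ofAdd t) * w = block j (.ofAdd (c * t)) := by
  have h : (MulAut.conj w⁻¹).toMonoidHom.comp (block j) =
      (block j).comp (AddMonoidHom.toMultiplicative (AddMonoidHom.mulLeft c)) := by
    refine Eisenstein.monoidHom_ext ?_ ?_
    · simpa [block_apply] using h1
    · simpa [block_apply] using h2
  simpa using DFunLike.congr_fun h (.ofAdd t)

theorem conj_u_block (j : Fin 4) (t : Eisenstein) : u⁻¹ * block j (.ofAdd t) * u =
    block j (.ofAdd (g3Data.z (g3Data.χ j (1, 0)) * t)) := by
  have h1 (a b : GroupG3) : a = a ^ (1 : ℤ) * b ^ (0 : ℤ) := by simp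
  have h2 (a b : GroupG3) : b = a ^ (0 : ℤ) * b ^ (1 : ℤ) := by simp
  have h3 (a b : GroupG3) : a⁻¹ * b⁻¹ = a ^ (-1 : ℤ) * b ^ (-1 : ℤ) := by simp
  refine conj_block ?_ ?_ t <;> rw [conj_u, block_apply] <;> fin_cases j
  exacts [h1 _ _, h2 _ _, h2 _ _, h2 _ _, h2 _ _, h3 (lat .e0) (lat .e0'), h3 (lat .e1) (lat .e1'),
    h3 (lat .e2) (lat .e2')]

theorem conj_v_block (j : Fin 4) (t : Eisenstein) : v⁻¹ * block j (.ofAdd t) * v =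
    block j (.ofAdd (g3Data.z (g3Data.χ j (0, 1)) * t)) := by
  have h1 (a b : GroupG3) : a = a ^ (1 : ℤ) * b ^ (0 : ℤ) := by simp
  have h2 (a b : GroupG3) : b = a ^ (0 : ℤ) * b ^ (1 : ℤ) := by simp
  have h3 (a b : GroupG3) : a⁻¹ * b⁻¹ = a ^ (-1 : ℤ) * b ^ (-1 : ℤ) := by simp
  refine conj_block ?_ ?_ t <;> rw [conj_v, block_apply] <;> fin_cases j
  exacts [h2 _ _, h1 _ _, h2 _ _, h3 (lat .e2) (lat .e2'), h3 (lat .eInf) (lat .eInf'), h2 _ _,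
    h3 (lat .e1) (lat .e1'), h1 _ _]

theorem exists_gen_eq (a : LatticeGen) : ∃ j, a = gen j ∨ a = gen' j := by
  cases a
  exacts [⟨0, .inl rfl⟩, ⟨0, .inr rfl⟩, ⟨1, .inl rfl⟩, ⟨1, .inr rfl⟩, ⟨2, .inl rfl⟩,
    ⟨2, .inr rfl⟩, ⟨3, .inl rfl⟩, ⟨3, .inr rfl⟩]

theorem lat_mem_range (a : LatticeGen) : lat a ∈ lattice.range := by
  obtain ⟨j, rfl | rfl⟩ := exists_gen_eq a
  · exact ⟨Pi.mulSingle j (.ofAdd 1), by simp [lattice_mulSingle, block_apply]⟩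
  · exact ⟨Pi.mulSingle j (.ofAdd ⟨0, 1⟩), by simp [lattice_mulSingle, block_apply]⟩

theorem lift_rels {G : Type*} [Group G] (f : G3Gen → G)
    (hcomm : ∀ a b, Commute (f (.lat a)) (f (.lat b)))
    (hu : ∀ a, (f .u)⁻¹ * f (.lat a) * f .u = FreeGroup.lift f (conjUWord a))
    (hv : ∀ a, (f .v)⁻¹ * f (.lat a) * f .v = FreeGroup.lift f (conjVWord a))
    (hu3 : f .u ^ 3 = f (.lat .eInf) ^ (-2 : ℤ) * (f (.lat .eInf'))⁻¹)
    (hv3 : f .v ^ 3 = f (.lat .e0) ^ 2 * f (.lat .e0'))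
    (huv : (f .u)⁻¹ * (f .v)⁻¹ * f .u * f .v =
      f (.lat .eInf) * f (.lat .e0) * f (.lat .e1) * f (.lat .e2)) :
    ∀ r ∈ g3Rels, FreeGroup.lift f r = 1 := by
  rintro r (((⟨a, b, rfl⟩ | ⟨a, rfl⟩) | ⟨a, rfl⟩) | rfl | rfl | rfl)
  · simp only [rightComm, latWord, map_mul, map_inv, FreeGroup.lift_apply_of]
    rw [mul_assoc, (hcomm a b).eq]
    group
  · rw [map_mul, map_inv, mul_inv_eq_one, ← hu]
    simp [rightConj, latWord]
  · rw [map_mul, map_inv, mul_inv_eq_one, ← hv]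
    simp [rightConj, latWord]
  · rw [map_mul, map_inv, mul_inv_eq_one]
    simpa [latWord] using hu3
  · rw [map_mul, map_inv, mul_inv_eq_one]
    simpa [latWord] using hv3
  · rw [map_mul, map_inv, mul_inv_eq_one]
    simpa [latWord, rightComm] using huv

/-- The images of the generators in the concrete crystallographic group. -/
def crystalGen : G3Gen → Crystal g3Data
  -- Since `3 = (1 - ω)(2 + ω)`, the entry `-1` here and the entry `1` in block 1 of `v` yield the
  -- prescribed cubes.
  | .u => ⟨(1, 0), ![-1, 0, 0, 0], by decide⟩
  | .v => ⟨(0, 1), ![0, 1, 1, 1], by decide⟩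
  | .lat .eInf => Crystal.translation _ (Pi.mulSingle 0 (.ofAdd 1))
  | .lat .eInf' => Crystal.translation _ (Pi.mulSingle 0 (.ofAdd ⟨0, 1⟩))
  | .lat .e0 => Crystal.translation _ (Pi.mulSingle 1 (.ofAdd 1))
  | .lat .e0' => Crystal.translation _ (Pi.mulSingle 1 (.ofAdd ⟨0, 1⟩))
  | .lat .e1 => Crystal.translation _ (Pi.mulSingle 2 (.ofAdd 1))
  | .lat .e1' => Crystal.translation _ (Pi.mulSingle 2 (.ofAdd ⟨0, 1⟩))
  | .lat .e2 => Crystal.translation _ (Pi.mulSingle 3 (.ofAdd 1))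
  | .lat .e2' => Crystal.translation _ (Pi.mulSingle 3 (.ofAdd ⟨0, 1⟩))

theorem crystalGen_lat (a : LatticeGen) :
    ∃ t, crystalGen (.lat a) = Crystal.translation g3Data t := by
  cases a <;> exact ⟨_, rfl⟩

/-- The map to the concrete crystallographic group. -/
def toCrystal : GroupG3 →* Crystal g3Data :=
  PresentedGroup.toGroup (f := crystalGen) <| lift_rels crystalGen
    (fun a b => by
      obtain ⟨s, hs⟩ := crystalGen_lat a
      obtain ⟨t, ht⟩ := crystalGen_lat b
      rw [hs, ht]
      exact (Commute.all s t).map _)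
    (fun a => by
      cases a <;> simp only [conjUWord, latWord, map_mul, map_inv, FreeGroup.lift_apply_of] <;>
        exact Crystal.ext' (by decide) (by decide))
    (fun a => by
      cases a <;> simp only [conjVWord, latWord, map_mul, map_inv, FreeGroup.lift_apply_of] <;>
        exact Crystal.ext' (by decide) (by decide))
    (Crystal.ext' (by decide) (by decide)) (Crystal.ext' (by decide) (by decide))
    (Crystal.ext' (by decide) (by decide))

@[simp] theorem toCrystal_of (g : G3Gen) : toCrystal (PresentedGroup.of g) = crystalGen g :=
  PresentedGroup.toGroup.of _

theorem toCrystal_gen (j : Fin 4) : toCrystal (lat (gen j)) =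
    Crystal.translation g3Data (Pi.mulSingle j (.ofAdd 1)) := by
  fin_cases j <;> exact toCrystal_of _

theorem toCrystal_gen' (j : Fin 4) : toCrystal (lat (gen' j)) =
    Crystal.translation g3Data (Pi.mulSingle j (.ofAdd ⟨0, 1⟩)) := by
  fin_cases j <;> exact toCrystal_of _

theorem toCrystal_lattice (a : Fin 4 → Multiplicative Eisenstein) :
    toCrystal (lattice a) = Crystal.translation g3Data a := by
  refine DFunLike.congr_fun (f := toCrystal.comp lattice) (MonoidHom.pi_ext fun j t => ?_) a
  rw [MonoidHom.comp_apply, lattice_mulSingle]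
  refine DFunLike.congr_fun (f := toCrystal.comp (block j)) (g := (Crystal.translation g3Data).comp
    (MonoidHom.mulSingle (fun _ => Multiplicative Eisenstein) j)) (Eisenstein.monoidHom_ext ?_ ?_) t
  · simpa [block_apply] using toCrystal_gen j
  · simpa [block_apply] using toCrystal_gen' j

theorem toCrystal_bijective : Function.Bijective toCrystal := by
  refine Crystal.bijective_of_lattice toCrystal lattice toCrystal_lattice u v ?_ ?_
    (mem_range_iff_conj_mem_range lattice u (fun j => g3Data.z (g3Data.χ j (1, 0)))
      (fun j => ?_) fun j a => ?_)
    (mem_range_iff_conj_mem_range lattice v (fun j => g3Data.z (g3Data.χ j (0, 1)))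
      (fun j => ?_) fun j a => ?_) ?_ ?_ ?_ ?_
  · rw [u, toCrystal_of, crystalGen]
  · rw [v, toCrystal_of, crystalGen]
  · exact IsUnit.of_mul_eq_one _ (g3Data.z_mul_neg _)
  · rw [lattice_mulSingle, lattice_mulSingle, conj_u_block]
  · exact IsUnit.of_mul_eq_one _ (g3Data.z_mul_neg _)
  · rw [lattice_mulSingle, lattice_mulSingle, conj_v_block]
  · rw [u_pow]
    exact mul_mem (zpow_mem (lat_mem_range _) _) (inv_mem (lat_mem_range _))
  · rw [v_pow]
    exact mul_mem (pow_mem (lat_mem_range _) _) (lat_mem_range _)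
  · rw [comm_u_v]
    exact mul_mem (mul_mem (mul_mem (lat_mem_range _) (lat_mem_range _)) (lat_mem_range _))
      (lat_mem_range _)
  · rw [eq_top_iff, ← closure_eq_top]
    refine Subgroup.closure_mono (Set.union_subset_union_right _ ?_)
    rintro _ ⟨a, rfl⟩
    exact lat_mem_range a

theorem properties : IsFGTorsionFreeResiduallyFinite GroupG3 ∧ HasMagnusProperty GroupG3 :=
  have : Finite G3Gen := Finite.of_surjective
    (fun o : Option (Option (Fin 4 × Bool)) => match o with
      | none => G3Gen.u
      | some none => G3Gen.v
      | some (some (j, b)) => G3Gen.lat (if b then gen j else gen' j))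
    fun g => by
      rcases g with _ | _ | a
      · exact ⟨none, rfl⟩
      · exact ⟨some none, rfl⟩
      · obtain ⟨j, rfl | rfl⟩ := exists_gen_eq a
        exacts [⟨some (some (j, true)), rfl⟩, ⟨some (some (j, false)), rfl⟩]
  isFGTorsionFreeResiduallyFinite_and_hasMagnusProperty_of_mulEquiv_crystal
    (PresentedGroup.fg _) (MulEquiv.ofBijective toCrystal toCrystal_bijective)

end GroupG3

/-! ### Failure of the Magnus property for the product -/

/-- If the image of `x` is central then its fourth power is trivial. -/
theorem HantzscheWendtGroup.map_x_pow_eq_one {Q : Type*} [Group Q] (f : HantzscheWendtGroup →* Q)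
    (hf : ∀ g, Commute (f x) (f g)) : f x ^ 4 = 1 := by
  have h := congrArg f conj_x_sq
  rw [map_mul, map_mul, map_inv, map_zpow, map_pow, mul_assoc, ((hf y).pow_left 2).eq,
    inv_mul_cancel_left] at h
  calc f x ^ 4 = f x ^ 2 * f x ^ 2 := by group
    _ = 1 := by nth_rw 1 [h]; group

/-- If the image of `u` is central then its cube is trivial. -/
theorem GroupG3.map_u_pow_eq_one {Q : Type*} [Group Q] (f : GroupG3 →* Q)
    (hf : ∀ g, Commute (f u) (f g)) : f u ^ 3 = 1 := by
  have hu : ∀ a, f (lat a) = f (PresentedGroup.mk g3Rels (conjUWord a)) := fun a => by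
    rw [← conj_u, map_mul, map_mul, map_inv, mul_assoc, ← (hf _).eq, inv_mul_cancel_left]
  have hv : ∀ a, (f v)⁻¹ * f (lat a) * f v = f (PresentedGroup.mk g3Rels (conjVWord a)) :=
    fun a => by rw [← conj_v, map_mul, map_mul, map_inv]
  have h0 : f (lat .e0) = f (lat .e0') := hu .e0
  have h1 : f (lat .e1) = f (lat .e1') := hu .e1
  have h2 : f (lat .e2) = f (lat .e2') := hu .e2
  have h2' : f (lat .e2') = f ((lat .e2)⁻¹ * (lat .e2')⁻¹) := hu .e2'
  have vInf : (f v)⁻¹ * f (lat .eInf) * f v = f (lat .eInf') := hv .eInf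
  have vInf' : (f v)⁻¹ * f (lat .eInf') * f v = f ((lat .eInf)⁻¹ * (lat .eInf')⁻¹) := hv .eInf'
  have v0 : (f v)⁻¹ * f (lat .e0) * f v = f (lat .e0) := hv .e0
  have v1 : (f v)⁻¹ * f (lat .e1) * f v = f (lat .e1') := hv .e1
  have v2 : (f v)⁻¹ * f (lat .e2) * f v = f ((lat .e2)⁻¹ * (lat .e2')⁻¹) := hv .e2
  -- Centrality of `u` identifies `e_i` with `ê_i` for `i = 0, 1, 2`, so `v` fixes their images.
  rw [← h1] at v1
  rw [← h2', ← h2] at v2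
  have hc : f (lat .eInf) * (f (lat .e0) * f (lat .e1) * f (lat .e2)) = 1 := by
    have h := congrArg f comm_u_v
    simp only [map_mul, map_inv] at h
    rw [mul_assoc, mul_assoc, (hf v).eq, inv_mul_cancel_left] at h
    rw [← mul_assoc, ← mul_assoc, ← h, inv_mul_cancel]
  have hc' : f (lat .eInf') * (f (lat .e0) * f (lat .e1) * f (lat .e2)) = 1 := by
    calc _ = (f v)⁻¹ * (f (lat .eInf) * (f (lat .e0) * f (lat .e1) * f (lat .e2))) * f v := by
          conv_lhs => rw [← vInf, ← v0, ← v1, ← v2]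
          group
      _ = 1 := by rw [hc, mul_one, inv_mul_cancel]
  -- The relation `[u, v] = 1` writes `e_∞` through elements fixed by `v`. Hence `ê_∞ = e_∞`, then
  -- `e_∞ ^ 3 = 1`, and `u ^ 3 = e_∞ ^ (-3)` is trivial.
  have hInf : f (lat .eInf') = f (lat .eInf) := mul_right_cancel (hc'.trans hc.symm)
  rw [hInf] at vInf
  rw [hInf, vInf, map_mul, map_inv, map_inv, hInf] at vInf'
  have h := congrArg f u_pow
  rw [map_pow, map_mul, map_zpow, map_inv, hInf] at h
  rw [h]
  calc f (lat .eInf) ^ (-2 : ℤ) * (f (lat .eInf))⁻¹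
      = ((f (lat .eInf))⁻¹ * (f (lat .eInf))⁻¹) * (f (lat .eInf))⁻¹ := by group
    _ = 1 := by rw [← vInf', mul_inv_cancel]

open HantzscheWendtGroup GroupG3

/-- The orders of `x` and `u` modulo commutators are coprime, so a normal subgroup containing the
pair contains both components. -/
theorem mem_of_prod_mem {N : Subgroup (HantzscheWendtGroup × GroupG3)} [N.Normal] {w : GroupG3}
    (hw : w = u ∨ w = u⁻¹) (hN : (x, w) ∈ N) : (x, 1) ∈ N ∧ (1, u) ∈ N := by
  let f := (QuotientGroup.mk' N).comp (MonoidHom.inl _ _)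
  let g := (QuotientGroup.mk' N).comp (MonoidHom.inr _ _)
  have hfg : ∀ a b, Commute (f a) (g b) := fun a b =>
    Commute.map (x := (a, (1 : GroupG3))) (y := ((1 : HantzscheWendtGroup), b))
      (by simp [Commute, SemiconjBy]) (QuotientGroup.mk' N)
  have hxw : f x * g w = 1 := by
    rw [← (QuotientGroup.eq_one_iff (N := N) (x, w)).2 hN]
    change QuotientGroup.mk' N (x, 1) * QuotientGroup.mk' N (1, w) = QuotientGroup.mk' N (x, w)
    rw [← map_mul]
    simp
  have hx : f x = (g w)⁻¹ := eq_inv_of_mul_eq_one_left hxw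
  have hu : g u = f x ∨ g u = (f x)⁻¹ := by
    rcases hw with rfl | rfl
    · right; rw [hx, inv_inv]
    · left; rw [hx, map_inv, inv_inv]
  -- The two factors commute, and `f x` is the inverse of an element of the second, so it is central
  -- in the image of the first; likewise for `g u`.
  have hx4 : f x ^ 4 = 1 := map_x_pow_eq_one f fun a => by
    rw [hx]; exact (hfg a w).symm.inv_left
  have hu3 : g u ^ 3 = 1 := map_u_pow_eq_one g fun b => by
    rcases hu with h | h <;> rw [h]
    · exact hfg x b
    · exact (hfg x b).inv_left
  have hx3 : f x ^ 3 = 1 := by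
    rcases hu with h | h
    · rwa [h] at hu3
    · rwa [h, inv_pow, inv_eq_one] at hu3
  have hx1 : f x = 1 := by rwa [pow_succ, hx3, one_mul] at hx4
  have hu1 : g u = 1 := by rcases hu with h | h <;> simp [h, hx1]
  exact ⟨(QuotientGroup.eq_one_iff (N := N) _).1 hx1, (QuotientGroup.eq_one_iff (N := N) _).1 hu1⟩

/-- A homomorphism detecting that `x` and `x⁻¹` are not conjugate. -/
def HantzscheWendtGroup.toZMod : HantzscheWendtGroup →* Multiplicative (ZMod 4) :=
  HantzscheWendtGroup.lift (.ofAdd 1) 1 (by decide) (by decide)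

/-- A homomorphism detecting that `u` and `u⁻¹` are not conjugate. -/
def GroupG3.toZMod : GroupG3 →* Multiplicative (ZMod 3) :=
  PresentedGroup.toGroup <| lift_rels
    (fun | .u => .ofAdd 1 | .v => 1 | .lat _ => 1)
    (fun _ _ => .refl _) (fun a => by cases a <;> simp [conjUWord, latWord])
    (fun a => by cases a <;> simp [conjVWord, latWord]) (by decide) (by decide) (by decide)

theorem not_hasMagnusProperty_prod : ¬ HasMagnusProperty (HantzscheWendtGroup × GroupG3) := by
  intro h
  have key : ∀ w w' : GroupG3, (w = u ∨ w = u⁻¹) → (w' = u ∨ w' = u⁻¹) →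
      Subgroup.normalClosure {((x : HantzscheWendtGroup), w)} ≤
        Subgroup.normalClosure {(x, w')} := by
    intro w w' hw hw'
    refine Subgroup.normalClosure_le_normal (Set.singleton_subset_iff.2 ?_)
    obtain ⟨h1, h2⟩ := mem_of_prod_mem hw' (Subgroup.subset_normalClosure rfl :
      ((x : HantzscheWendtGroup), w') ∈ Subgroup.normalClosure {(x, w')})
    rcases hw with rfl | rfl
    · simpa using mul_mem h1 h2
    · simpa using mul_mem h1 (inv_mem h2)
  have hu : GroupG3.toZMod u = .ofAdd 1 := PresentedGroup.toGroup.of _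
  have hx : HantzscheWendtGroup.toZMod x = .ofAdd 1 := lift_x _ _
  rcases h (x, u) (x, u⁻¹)
    (le_antisymm (key _ _ (.inl rfl) (.inr rfl)) (key _ _ (.inr rfl) (.inl rfl))) with h | h
  · have h1 := MonoidHom.map_isConj (GroupG3.toZMod.comp (MonoidHom.snd _ _)) h
    rw [isConj_iff_eq] at h1
    simp only [MonoidHom.comp_apply, MonoidHom.coe_snd, map_inv, hu] at h1
    exact absurd h1 (by decide)
  · have h1 := MonoidHom.map_isConj (HantzscheWendtGroup.toZMod.comp (MonoidHom.fst _ _)) h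
    rw [isConj_iff_eq] at h1
    simp only [MonoidHom.comp_apply, MonoidHom.coe_fst, map_inv, hx] at h1
    exact absurd h1 (by decide)

theorem IsFGTorsionFreeResiduallyFinite.prod {G H : Type*} [Group G] [Group H]
    (hG : IsFGTorsionFreeResiduallyFinite G) (hH : IsFGTorsionFreeResiduallyFinite H) :
    IsFGTorsionFreeResiduallyFinite (G × H) := by
  have := hG.fg
  have := hH.fg
  have := hG.residuallyFinite
  have := hH.residuallyFinite
  exact ⟨inferInstance, fun g hg => Prod.ext
    (hG.torsionFree _ ((MonoidHom.fst G H).isOfFinOrder hg))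
    (hH.torsionFree _ ((MonoidHom.snd G H).isOfFinOrder hg)), inferInstance⟩

end

/-- The Magnus property is not preserved under direct products within the class of finitely
generated, torsion-free, residually finite groups: the Hantzsche-Wendt group and `G_3` lie in
the class and have the Magnus property; their direct product lies in the class but does not
have the Magnus property. -/
theorem mainTheorem2 :
    (IsFGTorsionFreeResiduallyFinite HantzscheWendtGroup ∧
      HasMagnusProperty HantzscheWendtGroup) ∧
    (IsFGTorsionFreeResiduallyFinite GroupG3 ∧ HasMagnusProperty GroupG3) ∧
    (IsFGTorsionFreeResiduallyFinite (HantzscheWendtGroup × GroupG3) ∧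
      ¬ HasMagnusProperty (HantzscheWendtGroup × GroupG3)) :=
  ⟨HantzscheWendtGroup.properties, GroupG3.properties,
    HantzscheWendtGroup.properties.1.prod GroupG3.properties.1, not_hasMagnusProperty_prod⟩
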